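/- Let $(M,\mathcal T)$ be an ideally triangulated cusped $3$-manifold: $M$ is obtained from finitely many tetrahedra by gluing their faces in pairs by orientation-reversing maps and removing the vertices, and the link of every vertex is a torus. Let $E$ be the set of edges, $V$ the set of cusps, and $C\in\mathbb R^{V\times E}$ the cusp relation matrix, whose entry $C_{pe}$ is the number of ends of the edge $e$ on the cusp $p$. Let $\mathcal L(\mathcal T)\subset\mathbb R^E$ be the set of decorated hyperbolic polyhedral metrics, i.e. of those $l:E\to\mathbb R$ that restrict on every tetrahedron to the six (signed) edge lengths of a nondegenerate decorated hyperbolic ideal tetrahedron. For $l\in\mathcal L(\mathcal T)$ let $K_e(l)$ be $2\pi$ minus the sum of the dihedral angles along $e$. In a tetrahedron with vertices $i,j,k,h$ and arbitrary real numbers $l_{ij},\dots$ on its edges, let $\widetilde\alpha_{ij}$ be $\pi$ if $e^{(l_{ik}+l_{jh})/2}+e^{(l_{ih}+l_{jk})/2}\le e^{(l_{ij}+l_{kh})/2}$; $0$ if the corresponding inequality holds with $\{ij,kh\}$ replaced by $\{ik,jh\}$ or by $\{ih,jk\}$ as the pair on the right-hand side; and the dihedral angle at $ij$ of the decorated hyperbolic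 ideal tetrahedron with these edge lengths otherwise. For $l\in\mathbb R^E$ let $\widetilde K_e(l)$ be $2\pi$ minus the sum of the extended dihedral angles $\widetilde\alpha$ along $e$. The extended combinatorial Ricci flow is $\frac{dl}{dt}=\widetilde K(l)$, $l(0)=l_0\in\mathbb R^E$. We say that it converges exponentially fast from $l_0$ to $\bar l$ if its solution is unique and exists for all $t\ge 0$, and there are constants $A$ and $c>0$ with $\|l(t)-\bar l\|\le Ae^{-ct}$ for all $t\ge0$. Suppose that there is a complete hyperbolic metric on $(M,\mathcal T)$, that is, nondegenerate, positively oriented shapes of the ideal tetrahedra that solve Thurston's gluing and completeness equations. Then for every $l^*\in\mathbb R^E$ the following are equivalent: 1. $l^*\in\mathcal L(\mathcal T)$ and $K(l^*)=0$, i.e. $l^*$ is a decorated hyperbolic polyhedral metric with zero combinatorial Ricci curvature; 2. for every $l_0\in\mathbb R^E$ there is $x\in\mathbb R^V$ such that the extended flow converges exponentially fast from $l_0$ to $l^*+C^Tx$ (that is, to $l^*$ up to a change of decoration); 3. for every $l_0\in\mathbb R^E$ with $Cl_0=Cl^*$ (in particular, for every $l_0\in\operatorname{Ker}(C)$ if $l^*\in\operatorname{Ker}(C)$),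 the extended flow converges exponentially fast from $l_0$ to $l^*$. Moreover, for $l^*\in\mathcal L(\mathcal T)$ the equivalence of $K(l^*)=0$ with 2 and with 3 holds without assuming that there is a complete hyperbolic metric on $(M,\mathcal T)$. -/

import Mathlib

open Set Matrix

/-! ### Decorated hyperbolic ideal tetrahedra -/

/-- First endpoint of the `n`-th edge of the tetrahedron with vertices `0, 1, 2, 3`.  The six edges
are listed as `01, 02, 03, 23, 13, 12`, so that the `n`-th and the `(n+3)`-rd edge are opposite
(indices modulo 6). -/
def edgeFst : Fin 6 → Fin 4 := ![0, 0, 0, 2, 1, 1]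

/-- Second endpoint of the `n`-th edge. -/
def edgeSnd : Fin 6 → Fin 4 := ![1, 2, 3, 3, 3, 2]

/-- A nondegenerate decorated hyperbolic ideal tetrahedron in the upper half-space model of `ℍ³`
(up to an isometry, none of its four ideal vertices is `∞`): four distinct points of `ℂ ⊆ ∂ℍ³`
that do not lie on a common circle or line, i.e. whose cross ratio is not real, together with a
horosphere at each of them, given by its Euclidean diameter. -/
structure DecoratedIdealTetrahedron where
  vertex : Fin 4 → ℂ
  diam : Fin 4 → ℝ
  vertex_injective : Function.Injective vertex
  not_concyclic : (((vertex 0 - vertex 1) * (vertex 2 - vertex 3)) /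
    ((vertex 0 - vertex 2) * (vertex 1 - vertex 3))).im ≠ 0
  diam_pos : ∀ i, 0 < diam i

namespace DecoratedIdealTetrahedron

/-- The signed length of the `n`-th edge: the signed hyperbolic distance, along the geodesic with
ideal endpoints `p, q`, between the horospheres at `p, q` of Euclidean diameters `a, b`, which is
`log (|p - q|² / (a b))` (negative if the horospheres overlap). -/
noncomputable def length (D : DecoratedIdealTetrahedron) (n : Fin 6) : ℝ :=
  Real.log (‖D.vertex (edgeFst n) - D.vertex (edgeSnd n)‖ ^ 2 /
    (D.diam (edgeFst n) * D.diam (edgeSnd n)))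

/-- The dihedral angle along the `n`-th edge `ij`.  After sending the ideal vertex `i` to `∞` by
`w ↦ 1 / (w - vertex i)`, it is the angle at the image of `j` in the Euclidean triangle spanned by
the images of the three other vertices (the cross section of the tetrahedron by a horosphere
at `i`). -/
noncomputable def angle (D : DecoratedIdealTetrahedron) (n : Fin 6) : ℝ :=
  EuclideanGeometry.angle
    (1 / (D.vertex (edgeFst (n + 3)) - D.vertex (edgeFst n)))
    (1 / (D.vertex (edgeSnd n) - D.vertex (edgeFst n)))
    (1 / (D.vertex (edgeSnd (n + 3)) - D.vertex (edgeFst n)))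

end DecoratedIdealTetrahedron

/-- The space of the edge lengths of nondegenerate decorated hyperbolic ideal tetrahedra. -/
def tetAdmissible : Set (Fin 6 → ℝ) :=
  {ℓ | ∃ D : DecoratedIdealTetrahedron, D.length = ℓ}

open scoped Classical in
/-- The dihedral angle along the `n`-th edge of the decorated hyperbolic ideal tetrahedron with edge
lengths `ℓ` (the lengths determine the decorated tetrahedron up to isometry); `0` if there is no
such tetrahedron. -/
noncomputable def dihedralAngle (ℓ : Fin 6 → ℝ) (n : Fin 6) : ℝ :=
  if h : ∃ D : DecoratedIdealTetrahedron, D.length = ℓ then h.choose.angle n else 0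

/-- `exp ((l_ij + l_kh) / 2)` for the pair of opposite edges `ij`, `kh` containing the `n`-th. -/
noncomputable def oppositeExp (ℓ : Fin 6 → ℝ) (n : Fin 6) : ℝ :=
  Real.exp ((ℓ n + ℓ (n + 3)) / 2)

/-- The degenerate region `V_ij^kh`, where `ij` is the `n`-th edge. -/
def degenerateRegion (n : Fin 6) : Set (Fin 6 → ℝ) :=
  {ℓ | oppositeExp ℓ (n + 1) + oppositeExp ℓ (n + 2) ≤ oppositeExp ℓ n}

open scoped Classical in
/-- The extended dihedral angle along the `n`-th edge: `π` on the degenerate region of the `n`-th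
edge, `0` on the degenerate regions of the two other pairs of opposite edges, and the dihedral angle
elsewhere. -/
noncomputable def extendedAngle (ℓ : Fin 6 → ℝ) (n : Fin 6) : ℝ :=
  if ℓ ∈ degenerateRegion n then Real.pi
  else if ℓ ∈ degenerateRegion (n + 1) ∪ degenerateRegion (n + 2) then 0
  else dihedralAngle ℓ n

/-! ### Ideally triangulated cusped 3-manifolds -/

/-- An oriented triangulation, by the tetrahedra `t : T` with vertices `0, 1, 2, 3`, in which the
faces are glued in pairs.  The face of `t` opposite to its vertex `f` is glued to a face of `adj t f`
by the restriction of `glue t f`; the value `glue t f f` is the vertex opposite to that face.  All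
gluing maps reverse the orientation given by the order of the vertices, so that the space obtained
by gluing, with the vertices removed, is an oriented 3-manifold. -/
structure IdealTriangulation (T : Type*) where
  adj : T → Fin 4 → T
  glue : T → Fin 4 → Equiv.Perm (Fin 4)
  adj_adj : ∀ t f, adj (adj t f) (glue t f f) = t
  glue_glue : ∀ t f, glue (adj t f) (glue t f f) = (glue t f)⁻¹
  face_ne : ∀ t f, (adj t f, glue t f f) ≠ (t, f)
  oriented : ∀ t f, Equiv.Perm.sign (glue t f) = -1

namespace IdealTriangulation

variable {T : Type*}

/-- Edges of two tetrahedra are identified by the gluing of two faces. -/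
def EdgeRel (𝒯 : IdealTriangulation T) (a b : T × Fin 6) : Prop :=
  ∃ f : Fin 4, f ≠ edgeFst a.2 ∧ f ≠ edgeSnd a.2 ∧ b.1 = 𝒯.adj a.1 f ∧
    s(edgeFst b.2, edgeSnd b.2) =
      s(𝒯.glue a.1 f (edgeFst a.2), 𝒯.glue a.1 f (edgeSnd a.2))

/-- The edges of the triangulation: `Quot` divides by the equivalence relation that is generated by
the identifications. -/
def Edge (𝒯 : IdealTriangulation T) : Type _ := Quot 𝒯.EdgeRel

/-- The edge of the triangulation that comes from the `n`-th edge of the tetrahedron `t`. -/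
def edge (𝒯 : IdealTriangulation T) (t : T) (n : Fin 6) : 𝒯.Edge := Quot.mk _ (t, n)

/-- Vertices of two tetrahedra are identified by the gluing of two faces. -/
def VertexRel (𝒯 : IdealTriangulation T) (a b : T × Fin 4) : Prop :=
  ∃ f : Fin 4, f ≠ a.2 ∧ b = (𝒯.adj a.1 f, 𝒯.glue a.1 f a.2)

/-- The cusps, i.e. the (removed) vertices of the triangulation. -/
def Cusp (𝒯 : IdealTriangulation T) : Type _ := Quot 𝒯.VertexRel

/-- The cusp at the vertex `v` of the tetrahedron `t`. -/
def cusp (𝒯 : IdealTriangulation T) (t : T) (v : Fin 4) : 𝒯.Cusp := Quot.mk _ (t, v)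

theorem cusp_glue (𝒯 : IdealTriangulation T) (t : T) (f v : Fin 4) (h : f ≠ v) :
    𝒯.cusp (𝒯.adj t f) (𝒯.glue t f v) = 𝒯.cusp t v :=
  (Quot.sound ⟨f, h, rfl⟩).symm

noncomputable instance instFintypeEdge [Fintype T] (𝒯 : IdealTriangulation T) :
    Fintype 𝒯.Edge :=
  haveI : Finite 𝒯.Edge := inferInstanceAs (Finite (Quot 𝒯.EdgeRel))
  Fintype.ofFinite _

noncomputable instance instFintypeCusp [Fintype T] (𝒯 : IdealTriangulation T) :
    Fintype 𝒯.Cusp :=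
  haveI : Finite 𝒯.Cusp := inferInstanceAs (Finite (Quot 𝒯.VertexRel))
  Fintype.ofFinite _

open scoped Classical in
/-- The number of ends of the edge `e` on the cusp `p`. -/
noncomputable def numEnds (𝒯 : IdealTriangulation T) (p : 𝒯.Cusp) (e : 𝒯.Edge) : ℕ :=
  Quot.lift
    (fun a : T × Fin 6 =>
      (if 𝒯.cusp a.1 (edgeFst a.2) = p then 1 else 0) +
        (if 𝒯.cusp a.1 (edgeSnd a.2) = p then 1 else 0))
    (by
      rintro ⟨t, n⟩ ⟨t', m⟩ ⟨f, h1, h2, h3, h4⟩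
      dsimp only at h1 h2 h3 h4 ⊢
      subst h3
      rcases Sym2.eq_iff.1 h4 with ⟨h5, h6⟩ | ⟨h5, h6⟩
      · rw [h5, h6, cusp_glue _ _ _ _ h1, cusp_glue _ _ _ _ h2]
      · rw [h5, h6, cusp_glue _ _ _ _ h1, cusp_glue _ _ _ _ h2, add_comm])
    e

/-- The cusp relation matrix `C`. -/
noncomputable def cuspMatrix (𝒯 : IdealTriangulation T) : Matrix 𝒯.Cusp 𝒯.Edge ℝ :=
  fun p e => (𝒯.numEnds p e : ℝ)

open scoped Classical in
/-- The Euler characteristic of the link of the cusp `p`.  The link is triangulated by one triangle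
for each vertex of a tetrahedron at `p`; the sides of these triangles are glued in pairs; the
vertices of the link are the ends of edges on `p`. -/
noncomputable def linkEuler [Fintype T] (𝒯 : IdealTriangulation T) (p : 𝒯.Cusp) : ℚ :=
  let triangles : ℚ := (Finset.univ.filter fun a : T × Fin 4 => 𝒯.cusp a.1 a.2 = p).card
  (∑ e : 𝒯.Edge, (𝒯.numEnds p e : ℚ)) - 3 * triangles / 2 + triangles

/-- The link of each vertex is a torus.  (The links are connected closed oriented surfaces, so this
says that their Euler characteristic vanishes.) -/
def IsCusped [Fintype T] (𝒯 : IdealTriangulation T) : Prop :=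
  ∀ p : 𝒯.Cusp, 𝒯.linkEuler p = 0

/-! ### Decorated hyperbolic polyhedral metrics and combinatorial Ricci curvature -/

/-- The six edge lengths of the tetrahedron `t`. -/
def tetLengths (𝒯 : IdealTriangulation T) (l : 𝒯.Edge → ℝ) (t : T) : Fin 6 → ℝ :=
  fun n => l (𝒯.edge t n)

/-- The space `𝓛(𝒯)` of decorated hyperbolic polyhedral metrics. -/
def polyhedralMetrics (𝒯 : IdealTriangulation T) : Set (𝒯.Edge → ℝ) :=
  {l | ∀ t, 𝒯.tetLengths l t ∈ tetAdmissible}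

open scoped Classical in
/-- The combinatorial Ricci curvature: `2π` less the cone angle along the edge. -/
noncomputable def ricci [Fintype T] (𝒯 : IdealTriangulation T) (l : 𝒯.Edge → ℝ) (e : 𝒯.Edge) : ℝ :=
  2 * Real.pi -
    ∑ a ∈ Finset.univ.filter (fun a : T × Fin 6 => 𝒯.edge a.1 a.2 = e),
      dihedralAngle (𝒯.tetLengths l a.1) a.2

open scoped Classical in
/-- The extended combinatorial Ricci curvature. -/
noncomputable def extendedRicci [Fintype T] (𝒯 : IdealTriangulation T) (l : 𝒯.Edge → ℝ) :
    𝒯.Edge → ℝ := fun e =>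
  2 * Real.pi -
    ∑ a ∈ Finset.univ.filter (fun a : T × Fin 6 => 𝒯.edge a.1 a.2 = e),
      extendedAngle (𝒯.tetLengths l a.1) a.2

/-! ### The extended combinatorial Ricci flow -/

/-- `l` solves the extended combinatorial Ricci flow on the time interval `I`, starting at `l₀`. -/
def IsExtendedRicciFlow [Fintype T] (𝒯 : IdealTriangulation T) (I : Set ℝ) (l₀ : 𝒯.Edge → ℝ)
    (l : ℝ → 𝒯.Edge → ℝ) : Prop :=
  l 0 = l₀ ∧ ∀ t ∈ I, HasDerivWithinAt l (𝒯.extendedRicci (l t)) I t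

/-- The solution of the extended combinatorial Ricci flow with initial value `l₀` exists for all
time (and every other solution on an interval `[0, τ)` is a restriction of it), and it converges
exponentially fast to `lim`. -/
def ExtendedFlowConvergesTo [Fintype T] (𝒯 : IdealTriangulation T) (l₀ lim : 𝒯.Edge → ℝ) : Prop :=
  ∃ l : ℝ → 𝒯.Edge → ℝ,
    𝒯.IsExtendedRicciFlow (Ici 0) l₀ l ∧
    (∀ (τ : ℝ) (l' : ℝ → 𝒯.Edge → ℝ), 0 < τ → 𝒯.IsExtendedRicciFlow (Ico 0 τ) l₀ l' →
      EqOn l' l (Ico 0 τ)) ∧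
    ∃ A c : ℝ, 0 < c ∧ ∀ t : ℝ, 0 ≤ t → ‖l t - lim‖ ≤ A * Real.exp (-(c * t))

/-! ### Complete hyperbolic metrics -/

/-- The shape parameter at the `n`-th edge of the hyperbolic ideal tetrahedron with shape `z`: in
counterclockwise order around each ideal vertex, the three edges have the parameters
`z`, `1 / (1 - z)`, `1 - 1 / z`, and opposite edges have the same parameter. -/
noncomputable def shapeAt (z : ℂ) : Fin 6 → ℂ :=
  ![z, 1 / (1 - z), 1 - 1 / z, z, 1 / (1 - z), 1 - 1 / z]

/-- Transport of tangent vectors along paths in the link of a cusp, for the similarity structure in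
which the vertex `v` of the tetrahedron `t` contributes a Euclidean triangle of shape `z t`.  The pair
`(t, σ)` stands for the oriented side of the triangle at the vertex `σ 0` of `t` that runs from the
edge `σ 0 σ 1` to the edge `σ 0 σ 2`; this side lies in the face of `t` opposite to `σ 3`.
`LinkTransport z a b c` says: developing along some path of triangles from the oriented side `a` to
the oriented side `b`, the vector of `b` is `c` times the vector of `a`. -/
inductive LinkTransport (𝒯 : IdealTriangulation T) (z : T → ℂ) (a : T × Equiv.Perm (Fin 4)) :
    T × Equiv.Perm (Fin 4) → ℂ → Prop
  | refl : LinkTransport 𝒯 z a a 1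
  /-- Turn around the starting point of the side, inside the triangle. -/
  | turn (t : T) (σ : Equiv.Perm (Fin 4)) (c : ℂ) (n : Fin 6) :
      LinkTransport 𝒯 z a (t, σ) c → s(edgeFst n, edgeSnd n) = s(σ 0, σ 1) →
      LinkTransport 𝒯 z a (t, σ * Equiv.swap 2 3)
        (shapeAt (z t) n ^ (Equiv.Perm.sign σ : ℤ) * c)
  /-- Reverse the side. -/
  | flip (t : T) (σ : Equiv.Perm (Fin 4)) (c : ℂ) :
      LinkTransport 𝒯 z a (t, σ) c → LinkTransport 𝒯 z a (t, σ * Equiv.swap 1 2) (-c)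
  /-- Cross the side into the adjacent triangle. -/
  | cross (t : T) (σ : Equiv.Perm (Fin 4)) (c : ℂ) :
      LinkTransport 𝒯 z a (t, σ) c →
      LinkTransport 𝒯 z a (𝒯.adj t (σ 3), 𝒯.glue t (σ 3) * σ) c

open scoped Classical in
/-- The ideally triangulated manifold carries a complete hyperbolic metric, i.e. Thurston's gluing
equations are solvable: there are nondegenerate positively oriented hyperbolic ideal tetrahedra, of
shapes `z t`, whose gluing is a hyperbolic manifold (around each edge the dihedral angles add up to
`2π` and the product of the shape parameters is `1`) that is complete (the similarity structure on
the link of each cusp is Euclidean with holonomy consisting of translations). -/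
def HasCompleteHyperbolicMetric [Fintype T] (𝒯 : IdealTriangulation T) : Prop :=
  ∃ z : T → ℂ, (∀ t, 0 < (z t).im) ∧
    (∀ e : 𝒯.Edge,
      ∑ a ∈ Finset.univ.filter (fun a : T × Fin 6 => 𝒯.edge a.1 a.2 = e),
        Complex.log (shapeAt (z a.1) a.2) = 2 * Real.pi * Complex.I) ∧
    ∀ (a : T × Equiv.Perm (Fin 4)) (c : ℂ), 𝒯.LinkTransport z a a c → c = 1

end IdealTriangulation

/-!
Write `x_n = exp ((l_ij + l_kh) / 2)`.  The cross sections of a decorated ideal tetrahedron are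
Euclidean triangles with sides proportional to `x_0, x_1, x_2`, and conversely every nondegenerate
triangle occurs (`mem_tetAdmissible_iff`).  So the dihedral angles are given by the law of cosines,
and because `arccos` is constant outside `[-1, 1]` the same formula gives the extended angles
(`extendedAngle_eq_lawAngle`).  In particular the extended curvature is continuous and bounded.

The angles of a Euclidean triangle are a monotone function of the logarithms of its sides
(`logAngle_monotone`): modulo scaling, the derivative at a nondegenerate triangle is a symmetric
positive definite form, and on the degenerate regions the angles are constant.  Hence the extended
curvature is dissipative (`IdealTriangulation.isDissipative_extendedRicci`).  For a continuous
bounded dissipative field, solutions with given initial value are unique and exist for all time,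
although the field is not Lipschitz (`IsDissipative.exists_integralCurve`).

Let `l` be a polyhedral metric.  There the monotonicity is strong, modulo deformations that are
similarities on all cross sections
(`IdealTriangulation.exists_extendedRicci_strongly_monotone`).  These deformations are the changes
of decoration, that is, the range of `Cᵀ`, which meets `ker C` in `0`
(`IdealTriangulation.exists_mul_dotProduct_le_shapeEnergy`).  As the links are tori, `C` annihilates
the curvature, so that the flow preserves `C l`.  If `l` is flat, it therefore attracts
exponentially all initial values `l₀` with `C l₀ = C l`; every other initial value has this property
for a suitable `l + Cᵀ x`, which is flat as well.

Conversely, a limit of the flow is a zero of the extended curvature.  If there is a complete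
hyperbolic metric, horospherical cross sections of its cusps make it a flat polyhedral metric
(`IdealTriangulation.HasCompleteHyperbolicMetric.exists_extendedRicci_eq_zero`), and strong
monotonicity at that metric shows that every zero of the extended curvature differs from it by
similarities of the cross sections, so that it is a polyhedral metric too
(`IdealTriangulation.mem_polyhedralMetrics_of_extendedRicci_eq_zero`).
-/

open Filter Topology

/-! ### Linear algebra in coordinates -/

theorem HasDerivWithinAt.dotProduct_sub_self {ι : Type*} [Fintype ι] {u v : ℝ → ι → ℝ}
    {u' v' : ι → ℝ} {s : Set ℝ} {t : ℝ} (hu : HasDerivWithinAt u u' s t)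
    (hv : HasDerivWithinAt v v' s t) :
    HasDerivWithinAt (fun t => (u t - v t) ⬝ᵥ (u t - v t))
      (2 * ((u' - v') ⬝ᵥ (u t - v t))) s t := by
  rw [hasDerivWithinAt_pi] at hu hv
  have h : HasDerivWithinAt (fun t => ∑ i, (u t i - v t i) * (u t i - v t i))
      (∑ i, ((u' i - v' i) * (u t i - v t i) + (u t i - v t i) * (u' i - v' i))) s t :=
    HasDerivWithinAt.fun_sum fun i _ => ((hu i).sub (hv i)).mul ((hu i).sub (hv i))
  refine h.congr_deriv ?_
  simp only [dotProduct, Pi.sub_apply, Finset.mul_sum]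
  exact Finset.sum_congr rfl fun i _ => by ring

theorem norm_sq_le_dotProduct_self {ι : Type*} [Fintype ι] (v : ι → ℝ) : ‖v‖ ^ 2 ≤ v ⬝ᵥ v := by
  have h0 : 0 ≤ v ⬝ᵥ v := Finset.sum_nonneg fun i _ => mul_self_nonneg (v i)
  rw [← Real.sqrt_le_sqrt_iff h0, Real.sqrt_sq (norm_nonneg v)]
  refine (pi_norm_le_iff_of_nonneg (Real.sqrt_nonneg _)).2 fun i => ?_
  rw [Real.norm_eq_abs]
  apply Real.abs_le_sqrt
  rw [sq]
  exact Finset.single_le_sum (f := fun i => v i * v i) (fun i _ => mul_self_nonneg (v i))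
    (Finset.mem_univ i)

theorem abs_dotProduct_le_card_mul_norm {ι : Type*} [Fintype ι] (u v : ι → ℝ) :
    |u ⬝ᵥ v| ≤ Fintype.card ι * (‖u‖ * ‖v‖) := by
  refine (Finset.abs_sum_le_sum_abs _ _).trans ?_
  rw [← nsmul_eq_mul]
  refine Finset.sum_le_card_nsmul _ _ _ fun i _ => ?_
  rw [abs_mul]
  exact mul_le_mul (norm_le_pi_norm u i) (norm_le_pi_norm v i) (abs_nonneg _) (norm_nonneg _)

/-- The matrices `A * Aᵀ` and `A` have the same range. -/
theorem exists_mulVec_transpose_mulVec_eq {m n : Type*} [Fintype m] [Fintype n]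
    (A : Matrix m n ℝ) (v : n → ℝ) : ∃ x : m → ℝ, A *ᵥ (Aᵀ *ᵥ x) = A *ᵥ v := by
  classical
  have hle : LinearMap.range (A * Aᵀ).mulVecLin ≤ LinearMap.range A.mulVecLin := by
    rw [mulVecLin_mul]; exact LinearMap.range_comp_le_range _ _
  have heq := Submodule.eq_of_le_of_finrank_eq hle A.rank_self_mul_transpose
  have hv : A *ᵥ v ∈ LinearMap.range (A * Aᵀ).mulVecLin := heq ▸ ⟨v, rfl⟩
  obtain ⟨x, hx⟩ := hv
  exact ⟨x, by rw [mulVec_mulVec]; exact hx⟩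

/-! ### Flows of dissipative vector fields -/

/-- A function on an interval with nonpositive derivative is bounded by its initial value. -/
theorem le_of_hasDerivWithinAt_nonpos {s : Set ℝ} (hs : Convex ℝ s) {f f' : ℝ → ℝ}
    (hf : ∀ t ∈ s, HasDerivWithinAt f (f' t) s t) (hf' : ∀ t ∈ s, f' t ≤ 0) {a b : ℝ}
    (ha : a ∈ s) (hb : b ∈ s) (hab : a ≤ b) : f b ≤ f a :=
  antitoneOn_of_hasDerivWithinAt_nonpos hs (fun t ht => (hf t ht).continuousWithinAt)
    (fun t ht => (hf t (interior_subset ht)).mono interior_subset)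
    (fun t ht => hf' t (interior_subset ht)) ha hb hab

/-- Monotonicity of `-F` for the Euclidean inner product. -/
def IsDissipative {ι : Type*} [Fintype ι] (F : (ι → ℝ) → ι → ℝ) : Prop :=
  ∀ x y, (F x - F y) ⬝ᵥ (x - y) ≤ 0

section Flow

variable {ι : Type*} [Fintype ι] {F : (ι → ℝ) → ι → ℝ}

/-- Trajectories of a dissipative field do not move apart. -/
theorem IsDissipative.dotProduct_sub_le (hF : IsDissipative F) {s : Set ℝ} (hs : Convex ℝ s)
    {u v : ℝ → ι → ℝ} (hu : ∀ t ∈ s, HasDerivWithinAt u (F (u t)) s t)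
    (hv : ∀ t ∈ s, HasDerivWithinAt v (F (v t)) s t) {a b : ℝ} (ha : a ∈ s) (hb : b ∈ s)
    (hab : a ≤ b) : (u b - v b) ⬝ᵥ (u b - v b) ≤ (u a - v a) ⬝ᵥ (u a - v a) :=
  le_of_hasDerivWithinAt_nonpos (f := fun t => (u t - v t) ⬝ᵥ (u t - v t)) hs
    (fun t ht => (hu t ht).dotProduct_sub_self (hv t ht))
    (fun t _ => by have := hF (u t) (v t); linarith) ha hb hab

theorem IsDissipative.eqOn (hF : IsDissipative F) {s : Set ℝ} (hs : Convex ℝ s)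
    (hs0 : ∀ t ∈ s, 0 ≤ t) (h0 : 0 ∈ s)
    {u v : ℝ → ι → ℝ} (hu : ∀ t ∈ s, HasDerivWithinAt u (F (u t)) s t)
    (hv : ∀ t ∈ s, HasDerivWithinAt v (F (v t)) s t) (huv : u 0 = v 0) : EqOn u v s := by
  intro t ht
  have h := hF.dotProduct_sub_le hs hu hv h0 ht (hs0 t ht)
  rw [huv, sub_self, zero_dotProduct] at h
  have h2 := (norm_sq_le_dotProduct_self (u t - v t)).trans h
  have h3 : ‖u t - v t‖ = 0 := by nlinarith [norm_nonneg (u t - v t)]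
  exact sub_eq_zero.1 (norm_eq_zero.1 h3)

/-- A bounded `C¹` vector field has integral curves on every interval `[0, τ]`. -/
theorem exists_integralCurve_of_contDiff {E : Type*} [NormedAddCommGroup E] [NormedSpace ℝ E]
    [FiniteDimensional ℝ E] {G : E → E} (hG : ContDiff ℝ 1 G) {M : ℝ} (hM : ∀ x, ‖G x‖ ≤ M)
    (x₀ : E) {τ : ℝ} (hτ : 0 ≤ τ) :
    ∃ u : ℝ → E, u 0 = x₀ ∧ ∀ t ∈ Icc 0 τ, HasDerivWithinAt u (G (u t)) (Icc 0 τ) t := by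
  have hM0 : 0 ≤ M := (norm_nonneg _).trans (hM x₀)
  obtain ⟨K, hK⟩ := hG.locallyLipschitz.locallyLipschitzOn.exists_lipschitzOnWith_of_compact
    (isCompact_closedBall x₀ (M * τ))
  let M' : NNReal := ⟨M, hM0⟩
  let τ' : NNReal := ⟨τ, hτ⟩
  have hPL : IsPicardLindelof (fun _ => G) (⟨0, le_refl 0, hτ⟩ : Icc 0 τ) x₀ (M' * τ') 0 M' K := by
    refine ⟨fun _ _ => hK, fun _ _ => continuousOn_const, fun _ _ x _ => hM x, ?_⟩
    simp only [sub_zero, max_eq_left hτ, NNReal.coe_zero]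
    exact le_refl (M * τ)
  exact hPL.exists_eq_forall_mem_Icc_hasDerivWithinAt₀

/-- The curves of two uniform approximations of a dissipative field stay close; the approximations
need not be dissipative. -/
theorem IsDissipative.norm_sub_sq_le (hF : IsDissipative F) {G H : (ι → ℝ) → ι → ℝ} {ε δ M τ : ℝ}
    (hG : ∀ x, ‖G x - F x‖ ≤ ε) (hH : ∀ x, ‖H x - F x‖ ≤ δ) (hGM : ∀ x, ‖G x‖ ≤ M)
    (hHM : ∀ x, ‖H x‖ ≤ M) {u v : ℝ → ι → ℝ}
    (hu : ∀ t ∈ Icc 0 τ, HasDerivWithinAt u (G (u t)) (Icc 0 τ) t)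
    (hv : ∀ t ∈ Icc 0 τ, HasDerivWithinAt v (H (v t)) (Icc 0 τ) t) (huv : u 0 = v 0)
    (hτ : 0 ≤ τ) :
    ‖u τ - v τ‖ ^ 2 ≤ 2 * (Fintype.card ι * ((ε + δ) * (2 * M * τ))) * τ := by
  have h0 : (0 : ℝ) ∈ Icc 0 τ := ⟨le_rfl, hτ⟩
  have hM0 : 0 ≤ M := (norm_nonneg _).trans (hGM 0)
  have hε : 0 ≤ ε := (norm_nonneg _).trans (hG 0)
  have hδ : 0 ≤ δ := (norm_nonneg _).trans (hH 0)
  have hdist : ∀ t ∈ Icc 0 τ, ‖u t - v t‖ ≤ 2 * M * τ := by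
    intro t ht
    have h1 := (convex_Icc 0 τ).norm_image_sub_le_of_norm_hasDerivWithin_le
      (f := fun t => u t - v t) (C := 2 * M) (fun s hs => (hu s hs).sub (hv s hs))
      (fun s _ => (norm_sub_le _ _).trans (by linarith [hGM (u s), hHM (v s)])) h0 ht
    simp only [huv, sub_self, sub_zero] at h1
    refine h1.trans ?_
    rw [Real.norm_eq_abs, abs_of_nonneg ht.1]
    exact mul_le_mul_of_nonneg_left ht.2 (by linarith)
  have hd : ∀ t ∈ Icc 0 τ, (G (u t) - H (v t)) ⬝ᵥ (u t - v t) ≤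
      Fintype.card ι * ((ε + δ) * (2 * M * τ)) := by
    intro t ht
    have h1 : (G (u t) - H (v t)) ⬝ᵥ (u t - v t) = (F (u t) - F (v t)) ⬝ᵥ (u t - v t) +
        ((G (u t) - F (u t)) - (H (v t) - F (v t))) ⬝ᵥ (u t - v t) := by
      rw [← add_dotProduct]; congr 1; abel
    rw [h1]
    have h2 := (le_abs_self _).trans (abs_dotProduct_le_card_mul_norm
      ((G (u t) - F (u t)) - (H (v t) - F (v t))) (u t - v t))
    have h3 : ‖(G (u t) - F (u t)) - (H (v t) - F (v t))‖ ≤ ε + δ :=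
      (norm_sub_le _ _).trans (add_le_add (hG _) (hH _))
    have h4 := mul_le_mul h3 (hdist t ht) (norm_nonneg _) (by linarith)
    have h5 := mul_le_mul_of_nonneg_left h4 (Nat.cast_nonneg (α := ℝ) (Fintype.card ι))
    linarith [hF (u t) (v t)]
  have h6 := le_of_hasDerivWithinAt_nonpos (convex_Icc 0 τ)
    (f := fun t => (u t - v t) ⬝ᵥ (u t - v t) -
      2 * (Fintype.card ι * ((ε + δ) * (2 * M * τ))) * t)
    (fun t ht => ((hu t ht).dotProduct_sub_self (hv t ht)).sub
      ((hasDerivWithinAt_id t _).const_mul (2 * (Fintype.card ι * ((ε + δ) * (2 * M * τ))))))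
    (fun t ht => by have := hd t ht; linarith) h0 ⟨hτ, le_rfl⟩ hτ
  simp only [huv, sub_self, zero_dotProduct, mul_zero] at h6
  linarith [norm_sq_le_dotProduct_self (u τ - v τ)]

/-- A continuous bounded dissipative vector field, which need not be Lipschitz, has global forward
integral curves: the curves of smooth approximations form a Cauchy sequence. -/
theorem IsDissipative.exists_integralCurve (hF : IsDissipative F) (hc : Continuous F) {M : ℝ}
    (hM : ∀ x, ‖F x‖ ≤ M) (x₀ : ι → ℝ) :
    ∃ u : ℝ → ι → ℝ, u 0 = x₀ ∧ ∀ t ∈ Ici (0 : ℝ), HasDerivWithinAt u (F (u t)) (Ici 0) t := by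
  have happ : ∀ n : ℕ, ∃ G : (ι → ℝ) → ι → ℝ, ContDiff ℝ 1 G ∧
      ∀ x, ‖G x - F x‖ ≤ 1 / ((n : ℝ) + 1) := by
    intro n
    obtain ⟨G, hG, h, -⟩ := hc.exists_contDiff_approx 1
      (continuous_const (y := 1 / ((n : ℝ) + 1))) (fun _ => by positivity)
    exact ⟨G, hG, fun x => by rw [← dist_eq_norm]; exact (h x).le⟩
  choose G hG hGF using happ
  have hε : ∀ n : ℕ, 1 / ((n : ℝ) + 1) ≤ 1 := fun n => by
    rw [div_le_one (by positivity)]; linarith [Nat.cast_nonneg (α := ℝ) n]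
  have hGM : ∀ n x, ‖G n x‖ ≤ M + 1 := by
    intro n x
    have h1 : G n x = F x + (G n x - F x) := by abel
    rw [h1]
    exact (norm_add_le _ _).trans (add_le_add (hM x) ((hGF n x).trans (hε n)))
  have hM0 : 0 ≤ M + 1 := (norm_nonneg _).trans (hGM 0 0)
  choose u hu0 hu using fun n : ℕ =>
    exists_integralCurve_of_contDiff (hG n) (hGM n) x₀ (Nat.cast_nonneg (α := ℝ) n)
  have hε0 : Tendsto (fun n : ℕ => 1 / ((n : ℝ) + 1)) atTop (𝓝 0) :=
    tendsto_one_div_add_atTop_nhds_zero_nat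
  -- the `n`-th curve exists on `[0, n]`, so that two of them are compared on `[0, min n m]`
  have hclose : ∀ (n m : ℕ) (t : ℝ), 0 ≤ t → t ≤ n → t ≤ m → ‖u n t - u m t‖ ^ 2 ≤
      2 * (Fintype.card ι * ((1 / ((n : ℝ) + 1) + 1 / ((m : ℝ) + 1)) * (2 * (M + 1) * t))) * t := by
    intro n m t ht hn hm
    have hsub : ∀ k : ℕ, t ≤ k → Icc 0 t ⊆ Icc 0 (k : ℝ) := fun k hk => Icc_subset_Icc_right hk
    exact hF.norm_sub_sq_le (hGF n) (hGF m) (hGM n) (hGM m)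
      (fun s hs => (hu n s (hsub n hn hs)).mono (hsub n hn))
      (fun s hs => (hu m s (hsub m hm hs)).mono (hsub m hm)) (by rw [hu0, hu0]) ht
  have hlim : ∀ t, 0 ≤ t → ∃ x, Tendsto (fun n => u n t) atTop (𝓝 x) := by
    intro t ht
    apply cauchySeq_tendsto_of_complete
    rw [cauchySeq_iff_tendsto_dist_atTop_0]
    have h1 : Tendsto (fun p : ℕ × ℕ => Real.sqrt (2 * (Fintype.card ι *
        ((1 / ((p.1 : ℝ) + 1) + 1 / ((p.2 : ℝ) + 1)) * (2 * (M + 1) * t))) * t)) atTop (𝓝 0) := by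
      have h2 : Tendsto (fun p : ℕ × ℕ => 1 / ((p.1 : ℝ) + 1) + 1 / ((p.2 : ℝ) + 1)) atTop
          (𝓝 (0 + 0)) := by
        rw [← prod_atTop_atTop_eq]
        exact (hε0.comp tendsto_fst).add (hε0.comp tendsto_snd)
      have h3 := ((((h2.mul_const (2 * (M + 1) * t)).const_mul
        (Fintype.card ι : ℝ)).const_mul 2).mul_const t).sqrt
      simpa using h3
    refine squeeze_zero' (Eventually.of_forall fun _ => dist_nonneg) ?_ h1
    obtain ⟨N, hN⟩ := exists_nat_ge t
    filter_upwards [eventually_ge_atTop (N, N)] with p hp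
    rw [dist_eq_norm]
    exact Real.le_sqrt_of_sq_le (hclose p.1 p.2 t ht (hN.trans (by exact_mod_cast hp.1))
      (hN.trans (by exact_mod_cast hp.2)))
  choose! v hv using hlim
  have hFG : ∀ t, 0 ≤ t → Tendsto (fun n => G n (u n t)) atTop (𝓝 (F (v t))) := by
    intro t ht
    have h1 : Tendsto (fun n => F (u n t)) atTop (𝓝 (F (v t))) :=
      (hc.tendsto _).comp (hv t ht)
    have h2 : Tendsto (fun n => G n (u n t) - F (u n t)) atTop (𝓝 0) :=
      squeeze_zero_norm (fun n => hGF n _) hε0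
    simpa using h2.add h1
  have hLip : ∀ s ∈ Ici (0 : ℝ), ∀ t ∈ Ici (0 : ℝ), ‖v t - v s‖ ≤ (M + 1) * ‖t - s‖ := by
    intro s hs t ht
    refine le_of_tendsto (((hv t ht).sub (hv s hs)).norm) ?_
    obtain ⟨N, hN⟩ := exists_nat_ge (max s t)
    filter_upwards [eventually_ge_atTop N] with n hn
    have hn' : max s t ≤ (n : ℝ) := hN.trans (by exact_mod_cast hn)
    exact (convex_Icc 0 (n : ℝ)).norm_image_sub_le_of_norm_hasDerivWithin_le (hu n)
      (fun x _ => hGM n _) ⟨hs, (le_max_left _ _).trans hn'⟩ ⟨ht, (le_max_right _ _).trans hn'⟩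
  have hvc : ContinuousOn v (Ici 0) := by
    have : LipschitzOnWith ⟨M + 1, hM0⟩ v (Ici 0) :=
      LipschitzOnWith.of_dist_le_mul fun t ht s hs => by
        rw [dist_eq_norm, dist_eq_norm]; exact hLip s hs t ht
    exact this.continuousOn
  have hFvc : ContinuousOn (fun t => F (v t)) (Ici 0) := hc.comp_continuousOn hvc
  -- the integral equation passes to the pointwise limit by dominated convergence
  have hint : ∀ t ∈ Ici (0 : ℝ), v t = x₀ + ∫ s in (0 : ℝ)..t, F (v s) := by
    intro t ht
    obtain ⟨N, hN⟩ := exists_nat_ge t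
    have hev : ∀ᶠ n : ℕ in atTop, t ≤ n := by
      filter_upwards [eventually_ge_atTop N] with n hn
      exact hN.trans (by exact_mod_cast hn)
    have hcn : ∀ n : ℕ, t ≤ n → ContinuousOn (fun s => G n (u n s)) (Icc 0 t) := fun n hn =>
      (hG n).continuous.comp_continuousOn fun s hs =>
        ((hu n s ⟨hs.1, hs.2.trans hn⟩).continuousWithinAt).mono (Icc_subset_Icc_right hn)
    have h1 : Tendsto (fun n => ∫ s in (0 : ℝ)..t, G n (u n s)) atTop
        (𝓝 (∫ s in (0 : ℝ)..t, F (v s))) := by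
      refine intervalIntegral.tendsto_integral_filter_of_dominated_convergence (fun _ => M + 1)
        ?_ ?_ (by simp) ?_
      · filter_upwards [hev] with n hn
        rw [uIoc_of_le ht]
        exact ((hcn n hn).mono Ioc_subset_Icc_self).aestronglyMeasurable measurableSet_Ioc
      · exact Eventually.of_forall fun n => Eventually.of_forall fun s _ => hGM n _
      · refine Eventually.of_forall fun s hs => hFG s ?_
        rw [uIoc_of_le ht] at hs
        exact hs.1.le
    have h2 : Tendsto (fun n => u n t) atTop (𝓝 (x₀ + ∫ s in (0 : ℝ)..t, F (v s))) := by
      refine (h1.const_add x₀).congr' ?_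
      filter_upwards [hev] with n hn
      rw [intervalIntegral.integral_eq_sub_of_hasDerivAt_of_le ht (f := u n), hu0]
      · abel
      · intro s hs
        exact ((hu n s ⟨hs.1, hs.2.trans hn⟩).continuousWithinAt).mono (Icc_subset_Icc_right hn)
      · intro s hs
        exact (hu n s ⟨hs.1.le, hs.2.le.trans hn⟩).hasDerivAt
          (Icc_mem_nhds hs.1 (hs.2.trans_le hn))
      · exact (hcn n hn).intervalIntegrable_of_Icc ht
    exact tendsto_nhds_unique (hv t ht) h2
  refine ⟨v, by simpa using hint 0 self_mem_Ici, fun t ht => ?_⟩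
  have hder : HasDerivWithinAt (fun t => x₀ + ∫ s in (0 : ℝ)..t, F (v s)) (F (v t)) (Ici 0) t := by
    -- the integrand is extended by a constant to negative times
    have hw : Continuous fun s : ℝ => F (v (max s 0)) :=
      hFvc.comp_continuous (continuous_id.max continuous_const) fun s => le_max_right s 0
    have h1 := (hw.integral_hasStrictDerivAt 0 t).hasDerivAt.hasDerivWithinAt (s := Ici 0)
    have h2 : ∀ t ∈ Ici (0 : ℝ),
        (∫ s in (0 : ℝ)..t, F (v s)) = ∫ s in (0 : ℝ)..t, F (v (max s 0)) := by
      intro t ht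
      refine intervalIntegral.integral_congr fun s hs => ?_
      rw [uIcc_of_le ht] at hs
      simp only [max_eq_left hs.1]
    rw [max_eq_left (show (0 : ℝ) ≤ t from ht)] at h1
    exact (h1.congr h2 (h2 t ht)).const_add x₀
  exact hder.congr hint (hint t ht)

/-- The limit of an integral curve of a continuous field is a zero of the field. -/
theorem eq_zero_of_integralCurve_tendsto (hc : Continuous F) {u : ℝ → ι → ℝ}
    (hu : ∀ t ∈ Ici (0 : ℝ), HasDerivWithinAt u (F (u t)) (Ici 0) t) {x : ι → ℝ}
    (hx : Tendsto u atTop (𝓝 x)) : F x = 0 := by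
  have hFu : Tendsto (fun t => F (u t)) atTop (𝓝 (F x)) := (hc.tendsto x).comp hx
  have hshift : Tendsto (fun t => u (t + 1) - u t) atTop (𝓝 (x - x)) :=
    (hx.comp (tendsto_atTop_add_const_right _ 1 tendsto_id)).sub hx
  rw [sub_self] at hshift
  rw [← norm_le_zero_iff]
  refine le_of_forall_pos_le_add fun ε hε => ?_
  obtain ⟨N, hN⟩ := eventually_atTop.1 ((Metric.tendsto_nhds.1 hFu) ε hε)
  have hlim : Tendsto (fun t => ‖u (t + 1) - u t - F x‖) atTop (𝓝 ‖0 - F x‖) :=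
    (hshift.sub_const _).norm
  rw [zero_sub, norm_neg] at hlim
  rw [zero_add]
  refine le_of_tendsto hlim ?_
  filter_upwards [eventually_ge_atTop (max N 0)] with t ht
  have hsub : Icc t (t + 1) ⊆ Ici 0 := fun s hs => (le_max_right N 0).trans (ht.trans hs.1)
  -- the mean value inequality for `s ↦ u s - s • F x` on `[t, t + 1]`
  have h1 := (convex_Icc t (t + 1)).norm_image_sub_le_of_norm_hasDerivWithin_le
    (f := fun s => u s - s • F x) (C := ε)
    (fun s hs => ((hu s (hsub hs)).mono hsub).sub
      ((hasDerivWithinAt_id s _).smul_const (F x)))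
    (fun s hs => by
      rw [one_smul, ← dist_eq_norm]
      exact (hN s ((le_max_left N 0).trans (ht.trans hs.1))).le)
    (left_mem_Icc.2 (by linarith)) (right_mem_Icc.2 (by linarith))
  have h2 : u (t + 1) - (t + 1) • F x - (u t - t • F x) = u (t + 1) - u t - F x := by
    rw [add_smul, one_smul]; abel
  rw [h2] at h1
  simpa using h1

/-- Exponential convergence follows from a quadratic estimate of the field along the curve. -/
theorem norm_sub_le_exp_of_dotProduct_le {u : ℝ → ι → ℝ}
    (hu : ∀ t ∈ Ici (0 : ℝ), HasDerivWithinAt u (F (u t)) (Ici 0) t) {x : ι → ℝ} {c : ℝ}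
    (h : ∀ t ∈ Ici (0 : ℝ), F (u t) ⬝ᵥ (u t - x) ≤ -c * ((u t - x) ⬝ᵥ (u t - x))) {t : ℝ}
    (ht : 0 ≤ t) :
    ‖u t - x‖ ≤ Real.sqrt ((u 0 - x) ⬝ᵥ (u 0 - x)) * Real.exp (-(c * t)) := by
  -- the squared Euclidean distance to `x`, multiplied by `exp (2 * c * t)`, does not increase
  have h1 := le_of_hasDerivWithinAt_nonpos (convex_Ici (0 : ℝ))
    (f := fun t => ((u t - x) ⬝ᵥ (u t - x)) * Real.exp (2 * c * t))
    (fun s hs => ((hu s hs).dotProduct_sub_self (hasDerivWithinAt_const s _ x)).mul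
      (((hasDerivWithinAt_id s _).const_mul (2 * c)).exp)) ?_ self_mem_Ici ht ht
  · simp only [mul_zero, Real.exp_zero, mul_one] at h1
    have h2 : ‖u t - x‖ ≤ Real.sqrt (((u 0 - x) ⬝ᵥ (u 0 - x)) * Real.exp (-(2 * c * t))) := by
      apply Real.le_sqrt_of_sq_le
      refine (norm_sq_le_dotProduct_self _).trans ?_
      rw [Real.exp_neg, ← div_eq_mul_inv, le_div_iff₀ (Real.exp_pos _)]
      exact h1
    refine h2.trans_eq ?_
    rw [Real.sqrt_mul' _ (Real.exp_pos _).le, ← Real.exp_half]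
    congr 2; ring
  · intro s hs
    have h3 := h s hs
    simp only [sub_zero, mul_one, id]
    have h4 := Real.exp_pos (2 * c * s)
    nlinarith

end Flow

/-! ### Angles of Euclidean triangles -/

/-- The angle opposite to the side `a` in the Euclidean triangle with sides `a, b, c`.  As `arccos`
is constant outside `[-1, 1]`, for positive `a, b, c` that violate a triangle inequality this is `π`
or `0`, according to whether `a` is the longest side. -/
noncomputable def triangleAngle (a b c : ℝ) : ℝ :=
  Real.arccos ((b ^ 2 + c ^ 2 - a ^ 2) / (2 * b * c))

theorem triangleAngle_comm (a b c : ℝ) : triangleAngle a b c = triangleAngle a c b := by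
  unfold triangleAngle
  congr 1
  rw [add_comm (b ^ 2), mul_right_comm]

theorem triangleAngle_mul {k : ℝ} (hk : k ≠ 0) (a b c : ℝ) :
    triangleAngle (k * a) (k * b) (k * c) = triangleAngle a b c := by
  unfold triangleAngle
  congr 1
  rw [show 2 * (k * b) * (k * c) = k ^ 2 * (2 * b * c) by ring,
    show (k * b) ^ 2 + (k * c) ^ 2 - (k * a) ^ 2 = k ^ 2 * (b ^ 2 + c ^ 2 - a ^ 2) by ring,
    mul_div_mul_left _ _ (pow_ne_zero 2 hk)]

theorem triangleAngle_eq_pi {a b c : ℝ} (hb : 0 < b) (hc : 0 < c) (h : b + c ≤ a) :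
    triangleAngle a b c = Real.pi := by
  apply Real.arccos_of_le_neg_one
  rw [div_le_iff₀ (by positivity)]
  nlinarith

theorem triangleAngle_eq_zero {a b c : ℝ} (ha : 0 < a) (hb : 0 < b) (hc : 0 < c) (h : a + b ≤ c) :
    triangleAngle a b c = 0 := by
  apply Real.arccos_of_one_le
  rw [le_div_iff₀ (by positivity)]
  nlinarith

theorem triangleAngle_eq_zero' {a b c : ℝ} (ha : 0 < a) (hb : 0 < b) (hc : 0 < c) (h : a + c ≤ b) :
    triangleAngle a b c = 0 := by
  rw [triangleAngle_comm]; exact triangleAngle_eq_zero ha hc hb h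

/-- The law of cosines. -/
theorem angle_eq_triangleAngle {V : Type*} [NormedAddCommGroup V] [InnerProductSpace ℝ V]
    (x y : V) : InnerProductGeometry.angle x y = triangleAngle ‖x - y‖ ‖x‖ ‖y‖ := by
  unfold InnerProductGeometry.angle triangleAngle
  congr 1
  rw [real_inner_eq_norm_mul_self_add_norm_mul_self_sub_norm_sub_mul_self_div_two, div_div,
    ← mul_assoc]
  simp only [sq]

/-- A nondegenerate triangle with given sides, with two vertices at `0` and `c`. -/
theorem exists_complex_norm_eq {a b c : ℝ} (ha : 0 < a) (hb : 0 < b) (hc : 0 < c)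
    (h1 : a < b + c) (h2 : b < c + a) (h3 : c < a + b) :
    ∃ w : ℂ, 0 < w.im ∧ ‖w‖ = b ∧ ‖w - c‖ = a := by
  set x : ℝ := (b ^ 2 + c ^ 2 - a ^ 2) / (2 * c) with hx
  have hxc : x * (2 * c) = b ^ 2 + c ^ 2 - a ^ 2 := by rw [hx]; field_simp
  have hpos : 0 < b ^ 2 - x ^ 2 := by
    have e : (b ^ 2 - x ^ 2) * (2 * c) ^ 2 =
        ((b + c + a) * (b + c - a)) * ((a - b + c) * (a + b - c)) := by
      have : (b ^ 2 - x ^ 2) * (2 * c) ^ 2 = b ^ 2 * (2 * c) ^ 2 - (x * (2 * c)) ^ 2 := by ring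
      rw [this, hxc]; ring
    have e2 : 0 < (b ^ 2 - x ^ 2) * (2 * c) ^ 2 := by
      rw [e]
      exact mul_pos (mul_pos (by linarith) (by linarith)) (mul_pos (by linarith) (by linarith))
    exact pos_of_mul_pos_left e2 (by positivity)
  have hs := Real.sq_sqrt hpos.le
  refine ⟨⟨x, Real.sqrt (b ^ 2 - x ^ 2)⟩, Real.sqrt_pos.2 hpos, ?_, ?_⟩
  · rw [← sq_eq_sq₀ (norm_nonneg _) hb.le, Complex.sq_norm, Complex.normSq_apply]
    simp only; nlinarith
  · rw [← sq_eq_sq₀ (norm_nonneg _) ha.le, Complex.sq_norm, Complex.normSq_apply]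
    simp only [Complex.sub_re, Complex.sub_im, Complex.ofReal_re, Complex.ofReal_im]
    nlinarith

/-- The three angles add up to `π`, also in the degenerate cases. -/
theorem triangleAngle_add_add {a b c : ℝ} (ha : 0 < a) (hb : 0 < b) (hc : 0 < c) :
    triangleAngle a b c + triangleAngle b c a + triangleAngle c a b = Real.pi := by
  rcases le_or_gt (b + c) a with h1 | h1
  · rw [triangleAngle_eq_pi hb hc h1, triangleAngle_eq_zero hb hc ha h1,
      triangleAngle_eq_zero' hc ha hb (by linarith)]; ring
  rcases le_or_gt (c + a) b with h2 | h2
  · rw [triangleAngle_eq_pi hc ha h2, triangleAngle_eq_zero hc ha hb h2,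
      triangleAngle_eq_zero' ha hb hc (by linarith)]; ring
  rcases le_or_gt (a + b) c with h3 | h3
  · rw [triangleAngle_eq_pi ha hb h3, triangleAngle_eq_zero ha hb hc h3,
      triangleAngle_eq_zero' hb hc ha (by linarith)]; ring
  obtain ⟨w, -, hw1, hw2⟩ := exists_complex_norm_eq ha hb hc h1 h2 h3
  have hw0 : w ≠ 0 := norm_pos_iff.1 (hw1 ▸ hb)
  have hc0 : (c : ℂ) ≠ 0 := by exact_mod_cast hc.ne'
  have hcn : ‖(c : ℂ)‖ = c := by rw [Complex.norm_real, Real.norm_eq_abs, abs_of_pos hc]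
  have hw3 : ‖(c : ℂ) - w‖ = a := by rw [norm_sub_rev, hw2]
  have h := InnerProductGeometry.angle_add_angle_sub_add_angle_sub_eq_pi w hc0
  rw [angle_eq_triangleAngle, angle_eq_triangleAngle, angle_eq_triangleAngle] at h
  simp only [sub_sub_cancel, hw1, hw2, hw3, hcn] at h
  rw [triangleAngle_comm c a b]
  linarith

/-- The angle opposite to the side of length `exp u` in the triangle with sides
`exp u`, `exp v`, `1`. -/
noncomputable def logAngle (u v : ℝ) : ℝ := triangleAngle (Real.exp u) (Real.exp v) 1

/-- `4` times the square of the area of the triangle with sides `a`, `b`, `1`; it is positive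
exactly for nondegenerate triangles. -/
noncomputable def heron (a b : ℝ) : ℝ := a ^ 2 * b ^ 2 - ((a ^ 2 + b ^ 2 - 1) / 2) ^ 2

theorem heron_comm (a b : ℝ) : heron a b = heron b a := by unfold heron; ring

theorem heron_pos {a b : ℝ} (ha : 0 < a) (hb : 0 < b) (h1 : a < b + 1) (h2 : b < a + 1)
    (h3 : 1 < a + b) : 0 < heron a b := by
  have e : heron a b = ((a + b - 1) * (a + b + 1)) * ((1 - a + b) * (1 + a - b)) / 4 := by
    unfold heron; ring
  rw [e]
  have := mul_pos (mul_pos (show 0 < a + b - 1 by linarith) (show 0 < a + b + 1 by linarith))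
    (mul_pos (show 0 < 1 - a + b by linarith) (show 0 < 1 + a - b by linarith))
  linarith

theorem continuous_triangleAngle_comp {X : Type*} [TopologicalSpace X] {a b c : X → ℝ}
    (ha : Continuous a) (hb : Continuous b) (hc : Continuous c) (hb0 : ∀ x, b x ≠ 0)
    (hc0 : ∀ x, c x ≠ 0) : Continuous fun x => triangleAngle (a x) (b x) (c x) :=
  Real.continuous_arccos.comp (Continuous.div (by fun_prop) (by fun_prop) fun x =>
    mul_ne_zero (mul_ne_zero two_ne_zero (hb0 x)) (hc0 x))

/-- In the triangle with sides `a = exp u`, `b = exp v`, `1` and with `K` twice the area, the angle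
opposite to `a` has the differential `(a² du - a b cos γ dv) / K`, where `γ` is opposite to `1`. -/
theorem hasDerivAt_logAngle {f g : ℝ → ℝ} {p q s : ℝ} (hf : HasDerivAt f p s)
    (hg : HasDerivAt g q s) (h : 0 < heron (Real.exp (f s)) (Real.exp (g s))) :
    HasDerivAt (fun s => logAngle (f s) (g s))
      ((Real.exp (f s) ^ 2 * p -
        (Real.exp (f s) ^ 2 + Real.exp (g s) ^ 2 - 1) / 2 * q) /
          Real.sqrt (heron (Real.exp (f s)) (Real.exp (g s)))) s := by
  set a := Real.exp (f s) with ha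
  set b := Real.exp (g s) with hb
  have hb0 : 0 < b := Real.exp_pos _
  have hcos : HasDerivAt
      (fun s => (Real.exp (g s) ^ 2 + 1 ^ 2 - Real.exp (f s) ^ 2) / (2 * Real.exp (g s) * 1))
      (-((a ^ 2 * p - (a ^ 2 + b ^ 2 - 1) / 2 * q) / b)) s := by
    have hE := hf.exp.pow 2
    have hG := hg.exp.pow 2
    refine (((hG.add_const ((1 : ℝ) ^ 2)).sub hE).div
      ((hg.exp.const_mul 2).mul_const 1) (by positivity)).congr_deriv ?_
    simp only [← ha, ← hb, Pi.sub_apply, Pi.pow_apply]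
    field_simp
    ring
  have h1 : 1 - ((b ^ 2 + 1 ^ 2 - a ^ 2) / (2 * b * 1)) ^ 2 = heron a b / b ^ 2 := by
    unfold heron; field_simp; ring
  have h2 : 0 < 1 - ((b ^ 2 + 1 ^ 2 - a ^ 2) / (2 * b * 1)) ^ 2 := by rw [h1]; positivity
  have h3 := (Real.hasDerivAt_arccos (x := (b ^ 2 + 1 ^ 2 - a ^ 2) / (2 * b * 1))
    (fun e => by rw [e] at h2; norm_num at h2) (fun e => by rw [e] at h2; norm_num at h2)).comp s
    hcos
  refine h3.congr_deriv ?_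
  rw [h1, Real.sqrt_div h.le, Real.sqrt_sq hb0.le]
  have := Real.sqrt_pos.2 h
  field_simp

/-- The angles of the triangle with sides `exp u`, `exp v`, `1`, paired with `(p, q)`, along the
line through `(u, v)` with direction `(p, q)`. -/
noncomputable def anglePairing (u v p q s : ℝ) : ℝ :=
  logAngle (u + s * p) (v + s * q) * p + logAngle (v + s * q) (u + s * p) * q

theorem continuous_anglePairing (u v p q : ℝ) : Continuous (anglePairing u v p q) := by
  unfold anglePairing logAngle
  refine Continuous.add (Continuous.mul ?_ continuous_const)
    (Continuous.mul ?_ continuous_const) <;>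
  exact continuous_triangleAngle_comp (by fun_prop) (by fun_prop) (by fun_prop)
    (fun x => (Real.exp_pos _).ne') (fun _ => one_ne_zero)

/-- A lower bound for the eigenvalues of the derivative of `(u, v) ↦ (logAngle u v, logAngle v u)`
(its determinant divided by its trace). -/
noncomputable def angleGap (u v : ℝ) : ℝ :=
  Real.sqrt (heron (Real.exp u) (Real.exp v)) / (Real.exp u ^ 2 + Real.exp v ^ 2)

theorem exists_hasDerivAt_anglePairing {u v p q s : ℝ}
    (h : 0 < heron (Real.exp (u + s * p)) (Real.exp (v + s * q))) :
    ∃ d, HasDerivAt (anglePairing u v p q) d s ∧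
      angleGap (u + s * p) (v + s * q) * (p ^ 2 + q ^ 2) ≤ d := by
  have hf : HasDerivAt (fun s : ℝ => u + s * p) p s := by
    simpa using ((hasDerivAt_id s).mul_const p).const_add u
  have hg : HasDerivAt (fun s : ℝ => v + s * q) q s := by
    simpa using ((hasDerivAt_id s).mul_const q).const_add v
  refine ⟨_, ((hasDerivAt_logAngle hf hg h).mul_const p).add
    ((hasDerivAt_logAngle hg hf (by rwa [heron_comm])).mul_const q), ?_⟩
  unfold angleGap
  rw [heron_comm (Real.exp (v + s * q))]
  set a := Real.exp (u + s * p)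
  set b := Real.exp (v + s * q)
  have ha : 0 < a := Real.exp_pos _
  have hK := Real.sqrt_pos.2 h
  have hK2 := Real.sq_sqrt h.le
  set K := Real.sqrt (heron a b)
  have e : ∀ x y : ℝ, x / K * p + y / K * q = (x * p + y * q) / K := fun x y => by ring
  rw [e, div_mul_eq_mul_div, div_le_div_iff₀ (by positivity) hK]
  have : K * (p ^ 2 + q ^ 2) * K = heron a b * (p ^ 2 + q ^ 2) := by rw [← hK2]; ring
  rw [this]
  unfold heron
  -- the difference of the two sides is the sum of these two squares
  nlinarith [sq_nonneg (a ^ 2 * p - (a ^ 2 + b ^ 2 - 1) / 2 * q),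
    sq_nonneg ((a ^ 2 + b ^ 2 - 1) / 2 * p - b ^ 2 * q)]

theorem angleGap_nonneg (u v : ℝ) : 0 ≤ angleGap u v := by
  unfold angleGap; positivity

/-- A closed set on which a function is constant can be disregarded in a proof that the function is
monotone: it suffices to compare the ends of intervals that do not meet it. -/
theorem le_of_const_on_isClosed {g : ℝ → ℝ} {D : Set ℝ} (hD : IsClosed D)
    (hg : ∀ x ∈ D, ∀ y ∈ D, g x = g y) {a b : ℝ} (hab : a ≤ b)
    (H : ∀ x y, x ≤ y → Ioo x y ⊆ Ioo a b → (∀ z ∈ Ioo x y, z ∉ D) → g x ≤ g y) :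
    g a ≤ g b := by
  rcases (D ∩ Icc a b).eq_empty_or_nonempty with h | h
  · refine H a b hab subset_rfl fun z hz hzD => ?_
    have : z ∈ D ∩ Icc a b := ⟨hzD, Ioo_subset_Icc_self hz⟩
    rw [h] at this
    exact this
  · have hc : IsCompact (D ∩ Icc a b) := isCompact_Icc.inter_left hD
    obtain ⟨x, hx, hxl⟩ := hc.exists_isLeast h
    obtain ⟨y, hy, hyl⟩ := hc.exists_isGreatest h
    have h1 : g a ≤ g x := H a x hx.2.1 (Ioo_subset_Ioo_right hx.2.2) fun z hz hzD =>
      absurd (hxl ⟨hzD, hz.1.le, hz.2.le.trans hx.2.2⟩) (not_le.2 hz.2)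
    have h2 : g y ≤ g b := H y b hy.2.2 (Ioo_subset_Ioo_left hy.2.1) fun z hz hzD =>
      absurd (hyl ⟨hzD, hy.2.1.trans hz.1.le, hz.2.le⟩) (not_le.2 hz.1)
    exact h1.trans ((hg x hx.1 y hy.1).trans_le h2)

theorem monotone_anglePairing (u v p q : ℝ) : Monotone (anglePairing u v p q) := by
  have hcf : Continuous fun s : ℝ => Real.exp (u + s * p) := by fun_prop
  have hcg : Continuous fun s : ℝ => Real.exp (v + s * q) := by fun_prop
  have hf0 : ∀ s : ℝ, 0 < Real.exp (u + s * p) := fun s => Real.exp_pos _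
  have hg0 : ∀ s : ℝ, 0 < Real.exp (v + s * q) := fun s => Real.exp_pos _
  -- the pairing is constant on each of the three closed sets where a triangle inequality fails
  have hv1 : ∀ x, Real.exp (v + x * q) + 1 ≤ Real.exp (u + x * p) →
      anglePairing u v p q x = Real.pi * p := fun x hx => by
    unfold anglePairing logAngle
    rw [triangleAngle_eq_pi (hg0 x) one_pos hx,
      triangleAngle_eq_zero' (hg0 x) (hf0 x) one_pos hx]
    ring
  have hv2 : ∀ x, Real.exp (u + x * p) + 1 ≤ Real.exp (v + x * q) →
      anglePairing u v p q x = Real.pi * q := fun x hx => by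
    unfold anglePairing logAngle
    rw [triangleAngle_eq_pi (hf0 x) one_pos hx,
      triangleAngle_eq_zero' (hf0 x) (hg0 x) one_pos hx]
    ring
  have hv3 : ∀ x, Real.exp (u + x * p) + Real.exp (v + x * q) ≤ 1 →
      anglePairing u v p q x = 0 := fun x hx => by
    unfold anglePairing logAngle
    rw [triangleAngle_eq_zero (hf0 x) (hg0 x) one_pos hx,
      triangleAngle_eq_zero (hg0 x) (hf0 x) one_pos (by rwa [add_comm])]
    ring
  intro x y hxy
  refine le_of_const_on_isClosed (D := {s | Real.exp (v + s * q) + 1 ≤ Real.exp (u + s * p)})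
    (isClosed_le (by fun_prop) hcf)
    (fun x hx y hy => (hv1 x hx).trans (hv1 y hy).symm) hxy ?_
  intro x₁ y₁ hxy₁ _ h₁
  refine le_of_const_on_isClosed (D := {s | Real.exp (u + s * p) + 1 ≤ Real.exp (v + s * q)})
    (isClosed_le (by fun_prop) hcg)
    (fun x hx y hy => (hv2 x hx).trans (hv2 y hy).symm) hxy₁ ?_
  intro x₂ y₂ hxy₂ hsub₂ h₂
  refine le_of_const_on_isClosed (D := {s | Real.exp (u + s * p) + Real.exp (v + s * q) ≤ 1})
    (isClosed_le (by fun_prop) continuous_const)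
    (fun x hx y hy => (hv3 x hx).trans (hv3 y hy).symm) hxy₂ ?_
  intro x₃ y₃ hxy₃ hsub₃ h₃
  have hpos : ∀ s ∈ Ioo x₃ y₃, 0 < heron (Real.exp (u + s * p)) (Real.exp (v + s * q)) :=
    fun s hs => heron_pos (hf0 s) (hg0 s) (not_le.1 (h₁ s (hsub₂ (hsub₃ hs))))
      (not_le.1 (h₂ s (hsub₃ hs))) (not_le.1 (h₃ s hs))
  have hd : ∀ s, ∃ d, s ∈ Ioo x₃ y₃ → HasDerivAt (anglePairing u v p q) d s ∧ 0 ≤ d := by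
    intro s
    by_cases hs : s ∈ Ioo x₃ y₃
    · obtain ⟨d, h1, h2⟩ := exists_hasDerivAt_anglePairing (hpos s hs)
      exact ⟨d, fun _ => ⟨h1, (mul_nonneg (angleGap_nonneg _ _) (by positivity)).trans h2⟩⟩
    · exact ⟨0, fun h => absurd h hs⟩
  choose d hd using hd
  refine monotoneOn_of_hasDerivWithinAt_nonneg (f' := d) (convex_Icc x₃ y₃)
    (continuous_anglePairing u v p q).continuousOn ?_ ?_ (left_mem_Icc.2 hxy₃)
    (right_mem_Icc.2 hxy₃) hxy₃
  · rw [interior_Icc]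
    exact fun s hs => (hd s hs).1.hasDerivWithinAt
  · rw [interior_Icc]
    exact fun s hs => (hd s hs).2

/-- The pair of angles is a monotone function of the logarithms of the sides. -/
theorem logAngle_monotone (u v p q : ℝ) :
    0 ≤ (logAngle (u + p) (v + q) - logAngle u v) * p +
      (logAngle (v + q) (u + p) - logAngle v u) * q := by
  have h := monotone_anglePairing u v p q zero_le_one
  simp only [anglePairing, zero_mul, one_mul, add_zero] at h
  linarith

/-- Strong monotonicity of the angles at a nondegenerate triangle, uniformly on bounded sets:
near the triangle it comes from the derivative, farther away from monotonicity along rays. -/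
theorem exists_logAngle_strongly_monotone {u v : ℝ} (h : 0 < heron (Real.exp u) (Real.exp v))
    {R : ℝ} (hR : 0 < R) :
    ∃ c, 0 < c ∧ ∀ p q, |p| ≤ R → |q| ≤ R →
      c * (p ^ 2 + q ^ 2) ≤ (logAngle (u + p) (v + q) - logAngle u v) * p +
        (logAngle (v + q) (u + p) - logAngle v u) * q := by
  have hgap : 0 < angleGap u v := by
    unfold angleGap
    have := Real.sqrt_pos.2 h
    positivity
  have hcont : Continuous fun x : ℝ × ℝ => angleGap x.1 x.2 := by
    unfold angleGap heron
    exact Continuous.div (by fun_prop) (by fun_prop) fun x => by positivity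
  obtain ⟨r, hr, hball⟩ := Metric.eventually_nhds_iff.1
    (hcont.continuousAt.eventually (lt_mem_nhds (a := angleGap u v / 2)
      (b := angleGap (u, v).1 (u, v).2)
      (by simp only; linarith)))
  -- for `s ≤ s₀`, the point at time `s` of the line lies in the ball of radius `r`
  set s₀ : ℝ := min 1 (r / (2 * R)) with hs₀
  have hs₀pos : 0 < s₀ := lt_min one_pos (by positivity)
  refine ⟨angleGap u v / 2 * s₀, by positivity, fun p q hp hq => ?_⟩
  have hnear : ∀ s ∈ Icc 0 s₀, angleGap u v / 2 < angleGap (u + s * p) (v + s * q) := by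
    intro s hs
    have hsR : s * R < r := by
      have h1 : s ≤ r / (2 * R) := hs.2.trans (min_le_right _ _)
      rw [le_div_iff₀ (by positivity)] at h1
      linarith
    have hb : ∀ x, |x| ≤ R → |s * x| < r := fun x hx => by
      rw [abs_mul, abs_of_nonneg hs.1]
      exact (mul_le_mul_of_nonneg_left hx hs.1).trans_lt hsR
    refine hball (y := (u + s * p, v + s * q)) ?_
    rw [Prod.dist_eq, Real.dist_eq, Real.dist_eq]
    simp only [add_sub_cancel_left]
    exact max_lt (hb p hp) (hb q hq)
  have hd : ∀ s, ∃ d, s ∈ Icc 0 s₀ → HasDerivAt (anglePairing u v p q) d s ∧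
      angleGap u v / 2 * (p ^ 2 + q ^ 2) ≤ d := by
    intro s
    by_cases hs : s ∈ Icc 0 s₀
    · have hpos : 0 < heron (Real.exp (u + s * p)) (Real.exp (v + s * q)) := by
        by_contra hneg
        have h0 : angleGap (u + s * p) (v + s * q) = 0 := by
          rw [angleGap, Real.sqrt_eq_zero'.2 (not_lt.1 hneg), zero_div]
        linarith [hnear s hs]
      obtain ⟨d, h1, h2⟩ := exists_hasDerivAt_anglePairing hpos
      exact ⟨d, fun _ => ⟨h1, (mul_le_mul_of_nonneg_right (hnear s hs).le
        (by positivity)).trans h2⟩⟩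
    · exact ⟨0, fun h => absurd h hs⟩
  choose d hd using hd
  have h1 := monotoneOn_of_hasDerivWithinAt_nonneg
    (f := fun s => anglePairing u v p q s - angleGap u v / 2 * (p ^ 2 + q ^ 2) * s)
    (f' := fun s => d s - angleGap u v / 2 * (p ^ 2 + q ^ 2) * 1) (convex_Icc 0 s₀)
    (((continuous_anglePairing u v p q).sub (by fun_prop)).continuousOn)
    (fun s hs => ((hd s (interior_subset hs)).1.sub
      ((hasDerivAt_id s).const_mul _)).hasDerivWithinAt)
    (fun s hs => by linarith [(hd s (interior_subset hs)).2])
    (left_mem_Icc.2 hs₀pos.le) (right_mem_Icc.2 hs₀pos.le) hs₀pos.le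
  have h2 := monotone_anglePairing u v p q (min_le_left 1 (r / (2 * R)))
  rw [← hs₀] at h2
  simp only [anglePairing, zero_mul, one_mul, add_zero, mul_zero, sub_zero] at h1 h2
  nlinarith

/-! ### Lengths and angles of decorated ideal tetrahedra -/

theorem oppositeExp_pos (ℓ : Fin 6 → ℝ) (n : Fin 6) : 0 < oppositeExp ℓ n := Real.exp_pos _

theorem oppositeExp_add_three (ℓ : Fin 6 → ℝ) (n : Fin 6) :
    oppositeExp ℓ (n + 3) = oppositeExp ℓ n := by
  unfold oppositeExp
  rw [add_assoc, show (3 : Fin 6) + 3 = 0 from rfl, add_zero, add_comm]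

/-- The triangle inequalities need to be checked for one of each pair of opposite edges. -/
theorem forall_oppositeExp_lt (ℓ : Fin 6 → ℝ) (n : Fin 6)
    (h0 : oppositeExp ℓ n < oppositeExp ℓ (n + 1) + oppositeExp ℓ (n + 2))
    (h1 : oppositeExp ℓ (n + 1) < oppositeExp ℓ (n + 2) + oppositeExp ℓ n)
    (h2 : oppositeExp ℓ (n + 2) < oppositeExp ℓ n + oppositeExp ℓ (n + 1)) (m : Fin 6) :
    oppositeExp ℓ m < oppositeExp ℓ (m + 1) + oppositeExp ℓ (m + 2) := by
  obtain ⟨k, rfl⟩ : ∃ k, m = n + k := ⟨m - n, by simp⟩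
  obtain ⟨X, hXdef⟩ : ∃ X : Fin 6 → ℝ, X = ![oppositeExp ℓ n, oppositeExp ℓ (n + 1),
    oppositeExp ℓ (n + 2), oppositeExp ℓ n, oppositeExp ℓ (n + 1), oppositeExp ℓ (n + 2)] :=
    ⟨_, rfl⟩
  have hX : ∀ k, oppositeExp ℓ (n + k) = X k := by
    have h3 : ∀ k, oppositeExp ℓ (n + (k + 3)) = oppositeExp ℓ (n + k) := fun k => by
      rw [← add_assoc, oppositeExp_add_three]
    intro k
    rw [hXdef]
    fin_cases k
    · exact congrArg _ (add_zero n)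
    · rfl
    · rfl
    · exact oppositeExp_add_three ℓ n
    · exact h3 1
    · exact h3 2
  rw [add_assoc, add_assoc, hX, hX, hX, hXdef]
  fin_cases k
  · exact h0
  · exact h1
  · exact h2
  · exact h0
  · exact h1
  · exact h2

/-- The angle along the `n`-th edge given by the law of cosines for the triangle with the sides
`exp ((l_ij + l_kh) / 2)`, which is similar to the cross sections at the ideal vertices. -/
noncomputable def lawAngle (ℓ : Fin 6 → ℝ) (n : Fin 6) : ℝ :=
  triangleAngle (oppositeExp ℓ n) (oppositeExp ℓ (n + 1)) (oppositeExp ℓ (n + 2))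

/-- The cross section at `i` of the ideal tetrahedron with vertices `i, j, a, b` is similar to the
triangle whose sides are the products of distances of opposite pairs of vertices. -/
theorem angle_inv_sub {i j a b : ℂ} (hj : j ≠ i) (ha : a ≠ i) (hb : b ≠ i) {k : ℝ} (hk : k ≠ 0) :
    EuclideanGeometry.angle (1 / (a - i)) (1 / (j - i)) (1 / (b - i)) =
      triangleAngle (k * (‖a - b‖ * ‖j - i‖)) (k * (‖j - a‖ * ‖b - i‖))
        (k * (‖j - b‖ * ‖a - i‖)) := by
  have hj' := sub_ne_zero.2 hj
  have ha' := sub_ne_zero.2 ha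
  have hb' := sub_ne_zero.2 hb
  have hn : ∀ x y : ℂ, x - i ≠ 0 → y - i ≠ 0 →
      ‖1 / (x - i) - 1 / (y - i)‖ = ‖x - y‖ / (‖x - i‖ * ‖y - i‖) := by
    intro x y hx hy
    rw [div_sub_div _ _ hx hy, norm_div, norm_mul, norm_sub_rev x y]
    congr 2; ring
  unfold EuclideanGeometry.angle
  rw [angle_eq_triangleAngle]
  simp only [vsub_eq_sub, sub_sub_sub_cancel_right]
  rw [hn a b ha' hb', hn a j ha' hj', hn b j hb' hj', norm_sub_rev a j, norm_sub_rev b j,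
    ← triangleAngle_mul (k := k * (‖a - i‖ * ‖b - i‖ * ‖j - i‖))
      (mul_ne_zero hk (mul_ne_zero (mul_ne_zero (norm_ne_zero_iff.2 ha') (norm_ne_zero_iff.2 hb'))
        (norm_ne_zero_iff.2 hj')))]
  have ha'' := norm_ne_zero_iff.2 ha'
  have hb'' := norm_ne_zero_iff.2 hb'
  have hj'' := norm_ne_zero_iff.2 hj'
  congr 1 <;> field_simp

theorem norm_triangle_strict {w : ℂ} (hw : w.im ≠ 0) :
    ‖w‖ < ‖w - 1‖ + 1 ∧ ‖w - 1‖ < ‖w‖ + 1 ∧ 1 < ‖w‖ + ‖w - 1‖ := by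
  have h1 : |w.re| < ‖w‖ := Complex.abs_re_lt_norm.2 hw
  have h2 : |(w - 1).re| < ‖w - 1‖ := Complex.abs_re_lt_norm.2 (by simpa using hw)
  have e1 : ‖w‖ ^ 2 = w.re ^ 2 + w.im ^ 2 := by
    rw [Complex.sq_norm, Complex.normSq_apply]; ring
  have e2 : ‖w - 1‖ ^ 2 = (w.re - 1) ^ 2 + w.im ^ 2 := by
    rw [Complex.sq_norm, Complex.normSq_apply]; simp; ring
  simp only [Complex.sub_re, Complex.one_re] at h2
  rw [abs_lt] at h1 h2
  refine ⟨?_, ?_, by linarith⟩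
  · by_contra h
    nlinarith [norm_nonneg w, norm_nonneg (w - 1)]
  · by_contra h
    nlinarith [norm_nonneg w, norm_nonneg (w - 1)]

namespace DecoratedIdealTetrahedron

theorem oppositeExp_length (D : DecoratedIdealTetrahedron) (n : Fin 6) :
    oppositeExp D.length n = (Real.sqrt (D.diam 0 * D.diam 1 * D.diam 2 * D.diam 3))⁻¹ *
      (‖D.vertex (edgeFst n) - D.vertex (edgeSnd n)‖ *
        ‖D.vertex (edgeFst (n + 3)) - D.vertex (edgeSnd (n + 3))‖) := by
  have hd : 0 < D.diam 0 * D.diam 1 * D.diam 2 * D.diam 3 :=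
    mul_pos (mul_pos (mul_pos (D.diam_pos _) (D.diam_pos _)) (D.diam_pos _)) (D.diam_pos _)
  have hne : ∀ m : Fin 6, 0 < ‖D.vertex (edgeFst m) - D.vertex (edgeSnd m)‖ := fun m =>
    norm_pos_iff.2 (sub_ne_zero.2 (D.vertex_injective.ne (by fin_cases m <;> decide)))
  have hpos : ∀ m : Fin 6, 0 < ‖D.vertex (edgeFst m) - D.vertex (edgeSnd m)‖ ^ 2 /
      (D.diam (edgeFst m) * D.diam (edgeSnd m)) := fun m =>
    div_pos (pow_pos (hne m) 2) (mul_pos (D.diam_pos _) (D.diam_pos _))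
  have hprod : D.diam (edgeFst n) * D.diam (edgeSnd n) *
      (D.diam (edgeFst (n + 3)) * D.diam (edgeSnd (n + 3))) =
      D.diam 0 * D.diam 1 * D.diam 2 * D.diam 3 := by
    fin_cases n <;> simp [edgeFst, edgeSnd] <;> ring
  unfold oppositeExp length
  rw [← Real.log_mul (hpos n).ne' (hpos (n + 3)).ne', Real.exp_half,
    Real.exp_log (mul_pos (hpos n) (hpos (n + 3))), div_mul_div_comm, hprod, ← mul_pow,
    Real.sqrt_div (sq_nonneg _), Real.sqrt_sq (mul_pos (hne n) (hne (n + 3))).le, div_eq_inv_mul]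

theorem angle_eq_lawAngle (D : DecoratedIdealTetrahedron) (n : Fin 6) :
    D.angle n = lawAngle D.length n := by
  have hd : 0 < D.diam 0 * D.diam 1 * D.diam 2 * D.diam 3 :=
    mul_pos (mul_pos (mul_pos (D.diam_pos _) (D.diam_pos _)) (D.diam_pos _)) (D.diam_pos _)
  unfold angle lawAngle
  simp only [oppositeExp_length]
  rw [angle_inv_sub (D.vertex_injective.ne (by fin_cases n <;> decide))
    (D.vertex_injective.ne (by fin_cases n <;> decide))
    (D.vertex_injective.ne (by fin_cases n <;> decide)) (inv_ne_zero (Real.sqrt_pos.2 hd).ne')]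
  generalize (Real.sqrt (D.diam 0 * D.diam 1 * D.diam 2 * D.diam 3))⁻¹ = k
  fin_cases n <;> simp [edgeFst, edgeSnd] <;>
  simp only [norm_sub_rev (D.vertex 1) (D.vertex 0), norm_sub_rev (D.vertex 2) (D.vertex 0),
    norm_sub_rev (D.vertex 3) (D.vertex 0), norm_sub_rev (D.vertex 2) (D.vertex 1),
    norm_sub_rev (D.vertex 3) (D.vertex 1), norm_sub_rev (D.vertex 3) (D.vertex 2)] <;>
  first
  | (congr 1 <;> ring1)
  | (rw [triangleAngle_comm]; congr 1 <;> ring)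

/-- The strict triangle inequalities come from the cross ratio `w` not being real: by the Plücker
relation, the three sides are proportional to `|w|`, `1`, `|w - 1|`. -/
theorem oppositeExp_lt (D : DecoratedIdealTetrahedron) (n : Fin 6) :
    oppositeExp D.length n < oppositeExp D.length (n + 1) + oppositeExp D.length (n + 2) := by
  have hne : ∀ i j : Fin 4, i ≠ j → D.vertex i - D.vertex j ≠ 0 := fun i j hij =>
    sub_ne_zero.2 (D.vertex_injective.ne hij)
  have h02 := hne 0 2 (by decide)
  have h13 := hne 1 3 (by decide)
  obtain ⟨h1, h2, h3⟩ := norm_triangle_strict D.not_concyclic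
  set w := ((D.vertex 0 - D.vertex 1) * (D.vertex 2 - D.vertex 3)) /
    ((D.vertex 0 - D.vertex 2) * (D.vertex 1 - D.vertex 3)) with hw
  have hw1 : w - 1 = -((D.vertex 0 - D.vertex 3) * (D.vertex 1 - D.vertex 2)) /
      ((D.vertex 0 - D.vertex 2) * (D.vertex 1 - D.vertex 3)) := by
    rw [hw]; field_simp; ring
  have hX1 := oppositeExp_pos D.length 1
  have e0 : oppositeExp D.length 0 = ‖w‖ * oppositeExp D.length 1 := by
    rw [oppositeExp_length, oppositeExp_length, hw, norm_div, norm_mul, norm_mul]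
    have := norm_ne_zero_iff.2 h02
    have := norm_ne_zero_iff.2 h13
    simp [edgeFst, edgeSnd]
    field_simp
  have e2 : oppositeExp D.length 2 = ‖w - 1‖ * oppositeExp D.length 1 := by
    rw [oppositeExp_length, oppositeExp_length, hw1, norm_div, norm_neg, norm_mul, norm_mul]
    have := norm_ne_zero_iff.2 h02
    have := norm_ne_zero_iff.2 h13
    simp [edgeFst, edgeSnd]
    field_simp
  refine forall_oppositeExp_lt _ 0 ?_ ?_ ?_ n
  · change oppositeExp D.length 0 < oppositeExp D.length 1 + oppositeExp D.length 2
    rw [e0, e2]; nlinarith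
  · change oppositeExp D.length 1 < oppositeExp D.length 2 + oppositeExp D.length 0
    rw [e0, e2]; nlinarith
  · change oppositeExp D.length 2 < oppositeExp D.length 0 + oppositeExp D.length 1
    rw [e0, e2]; nlinarith

end DecoratedIdealTetrahedron

/-- Horospheres at given ideal vertices with given edge lengths exist as soon as the Euclidean
distances of the vertices have the ratios of products of opposite sides that the lengths require:
the condition on the diameters is `d i * d j = (|p i - p j| / exp (l_ij / 2)) ^ 2`. -/
theorem mem_tetAdmissible_of_vertices {ℓ : Fin 6 → ℝ} {p : Fin 4 → ℂ} (hp : Function.Injective p)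
    (him : (((p 0 - p 1) * (p 2 - p 3)) / ((p 0 - p 2) * (p 1 - p 3))).im ≠ 0) {k : ℝ}
    (hk : ∀ n, ‖p (edgeFst n) - p (edgeSnd n)‖ * ‖p (edgeFst (n + 3)) - p (edgeSnd (n + 3))‖ =
      k * oppositeExp ℓ n) : ℓ ∈ tetAdmissible := by
  let ρ : Fin 6 → ℝ := fun n => ‖p (edgeFst n) - p (edgeSnd n)‖ / Real.exp (ℓ n / 2)
  have hm : ∀ n : Fin 6, 0 < ‖p (edgeFst n) - p (edgeSnd n)‖ := fun n =>
    norm_pos_iff.2 (sub_ne_zero.2 (hp.ne (by fin_cases n <;> decide)))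
  have hρ : ∀ n, 0 < ρ n := fun n => div_pos (hm n) (Real.exp_pos _)
  have hρk : ∀ n, ρ n * ρ (n + 3) = k := by
    intro n
    simp only [ρ]
    rw [div_mul_div_comm, hk, ← Real.exp_add, ← add_div, oppositeExp,
      mul_div_cancel_right₀ _ (Real.exp_pos _).ne']
  have h0 : ρ 0 * ρ 3 = k := hρk 0
  have h1 : ρ 1 * ρ 4 = k := hρk 1
  have h2 : ρ 2 * ρ 5 = k := hρk 2
  have p0 := hρ 0
  have p1 := hρ 1
  have p2 := hρ 2
  have p5 := hρ 5
  -- `d 0`, `d 1`, `d 2` are determined by the face `012`, and `d 3` by the edge `03`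
  let d : Fin 4 → ℝ := ![ρ 0 * ρ 1 / ρ 5, ρ 0 * ρ 5 / ρ 1, ρ 1 * ρ 5 / ρ 0,
    ρ 2 ^ 2 * ρ 5 / (ρ 0 * ρ 1)]
  have hd : ∀ i, 0 < d i := by
    intro i
    fin_cases i <;> simp [d] <;> positivity
  have hdd : ∀ n, d (edgeFst n) * d (edgeSnd n) = ρ n ^ 2 := by
    intro n
    have e3 : ρ 3 = ρ 2 * ρ 5 / ρ 0 := by rw [eq_div_iff p0.ne', h2, ← h0, mul_comm]
    have e4 : ρ 4 = ρ 2 * ρ 5 / ρ 1 := by rw [eq_div_iff p1.ne', h2, ← h1, mul_comm]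
    fin_cases n <;> simp [d, edgeFst, edgeSnd] <;> (try simp only [e3, e4]) <;> field_simp
  refine ⟨⟨p, d, hp, him, hd⟩, funext fun n => ?_⟩
  change Real.log (‖p (edgeFst n) - p (edgeSnd n)‖ ^ 2 / (d (edgeFst n) * d (edgeSnd n))) = ℓ n
  rw [hdd, div_pow, div_div_cancel₀ (pow_pos (hm n) 2).ne', ← Real.exp_nat_mul, Real.log_exp]
  push_cast; ring

/-- Lengths that violate no triangle inequality are realized by a decorated tetrahedron. -/
theorem mem_tetAdmissible_of_lt {ℓ : Fin 6 → ℝ}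
    (h : ∀ n, oppositeExp ℓ n < oppositeExp ℓ (n + 1) + oppositeExp ℓ (n + 2)) :
    ℓ ∈ tetAdmissible := by
  have hX0 := oppositeExp_pos ℓ 0
  have hX1 := oppositeExp_pos ℓ 1
  have hX2 := oppositeExp_pos ℓ 2
  have g0 : oppositeExp ℓ 0 < oppositeExp ℓ 1 + oppositeExp ℓ 2 := h 0
  have g1 : oppositeExp ℓ 1 < oppositeExp ℓ 2 + oppositeExp ℓ 0 :=
    oppositeExp_add_three ℓ 0 ▸ h 1
  have g2 : oppositeExp ℓ 2 < oppositeExp ℓ 0 + oppositeExp ℓ 1 :=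
    oppositeExp_add_three ℓ 0 ▸ oppositeExp_add_three ℓ 1 ▸ h 2
  obtain ⟨w, hw, hw0, hw1⟩ := exists_complex_norm_eq (a := oppositeExp ℓ 2 / oppositeExp ℓ 1)
    (b := oppositeExp ℓ 0 / oppositeExp ℓ 1) (c := 1) (by positivity) (by positivity) one_pos
    (by rw [div_lt_iff₀ hX1, add_mul, div_mul_cancel₀ _ hX1.ne']; linarith)
    (by rw [div_lt_iff₀ hX1, add_mul, div_mul_cancel₀ _ hX1.ne']; linarith)
    (by rw [← add_div, lt_div_iff₀ hX1]; linarith)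
  rw [Complex.ofReal_one] at hw1
  have n2 : 2 - w ≠ 0 := fun h => by
    have := congrArg Complex.im h
    simp at this; linarith
  have n1 : 1 - w ≠ 0 := fun h => by
    have := congrArg Complex.im h
    simp at this; linarith
  have n0 : w ≠ 0 := fun h => by
    rw [h] at hw; simp at hw
  -- four points with cross ratio `w`
  let p : Fin 4 → ℂ := ![0, 1, 1 / (2 - w), 1 / 2]
  have e23 : 1 / (2 - w) - 1 / 2 = w / (2 * (2 - w)) := by field_simp; ring
  have e12 : 1 - 1 / (2 - w) = (1 - w) / (2 - w) := by field_simp; ring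
  have hcr : ((p 0 - p 1) * (p 2 - p 3)) / ((p 0 - p 2) * (p 1 - p 3)) = w := by
    simp only [p, cons_val]
    rw [e23]
    field_simp
    norm_num
  have hp : ∀ i j : Fin 4, i < j → p i - p j ≠ 0 := by
    have k12 := div_ne_zero n1 n2
    have k23 := div_ne_zero n0 (mul_ne_zero two_ne_zero n2)
    rw [← e12] at k12
    rw [← e23] at k23
    intro i j hij
    fin_cases i <;> fin_cases j <;> first | exact absurd hij (by decide) | skip
    · simp [p]
    · simpa [p] using n2
    · simp [p]
    · exact k12
    · norm_num [p]
    · exact k23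
  have hinj : Function.Injective p := by
    intro i j hij
    rcases lt_trichotomy i j with h | h | h
    · exact absurd (sub_eq_zero.2 hij) (hp i j h)
    · exact h
    · exact absurd (sub_eq_zero.2 hij.symm) (hp j i h)
  have m2 := norm_pos_iff.2 n2
  refine mem_tetAdmissible_of_vertices (k := 1 / (2 * ‖2 - w‖) / oppositeExp ℓ 1) hinj
    (by rw [hcr]; exact hw.ne') ?_
  have k0 : ‖p 0 - p 1‖ * ‖p 2 - p 3‖ = 1 / (2 * ‖2 - w‖) / oppositeExp ℓ 1 * oppositeExp ℓ 0 := by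
    simp only [p, cons_val]
    rw [e23, norm_div, hw0, norm_mul]
    simp
    field_simp
  have k1 : ‖p 0 - p 2‖ * ‖p 1 - p 3‖ = 1 / (2 * ‖2 - w‖) / oppositeExp ℓ 1 * oppositeExp ℓ 1 := by
    simp only [p, cons_val]
    rw [show (1 : ℂ) - 1 / 2 = 1 / 2 by norm_num]
    simp
    field_simp
  have k2 : ‖p 0 - p 3‖ * ‖p 1 - p 2‖ = 1 / (2 * ‖2 - w‖) / oppositeExp ℓ 1 * oppositeExp ℓ 2 := by
    simp only [p, cons_val]
    rw [e12, norm_div, norm_sub_rev 1 w, hw1]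
    simp
    field_simp
  intro n
  fin_cases n
  · exact k0
  · exact k1
  · exact k2
  · exact (mul_comm _ _).trans (k0.trans (by rw [← oppositeExp_add_three ℓ 0]; rfl))
  · exact (mul_comm _ _).trans (k1.trans (by rw [← oppositeExp_add_three ℓ 1]; rfl))
  · exact (mul_comm _ _).trans (k2.trans (by rw [← oppositeExp_add_three ℓ 2]; rfl))

theorem mem_tetAdmissible_iff {ℓ : Fin 6 → ℝ} :
    ℓ ∈ tetAdmissible ↔
      ∀ n, oppositeExp ℓ n < oppositeExp ℓ (n + 1) + oppositeExp ℓ (n + 2) :=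
  ⟨fun ⟨D, hD⟩ n => hD ▸ D.oppositeExp_lt n, mem_tetAdmissible_of_lt⟩

theorem dihedralAngle_eq_lawAngle {ℓ : Fin 6 → ℝ} (h : ℓ ∈ tetAdmissible) (n : Fin 6) :
    dihedralAngle ℓ n = lawAngle ℓ n := by
  have h' : ∃ D : DecoratedIdealTetrahedron, D.length = ℓ := h
  unfold dihedralAngle
  rw [dif_pos h', DecoratedIdealTetrahedron.angle_eq_lawAngle, h'.choose_spec]

/-- The extended dihedral angles are given by the law of cosines everywhere, because `arccos` is
extended by constants. -/
theorem extendedAngle_eq_lawAngle (ℓ : Fin 6 → ℝ) (n : Fin 6) :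
    extendedAngle ℓ n = lawAngle ℓ n := by
  have h3 : oppositeExp ℓ (n + 1 + 2) = oppositeExp ℓ n := by
    rw [← oppositeExp_add_three ℓ n, add_assoc]; rfl
  have h4 : oppositeExp ℓ (n + 2 + 1) = oppositeExp ℓ n := by
    rw [← oppositeExp_add_three ℓ n, add_assoc]; rfl
  have h5 : oppositeExp ℓ (n + 2 + 2) = oppositeExp ℓ (n + 1) := by
    rw [← oppositeExp_add_three ℓ (n + 1), add_assoc, add_assoc]; rfl
  have h6 : n + 1 + 1 = n + 2 := by rw [add_assoc]; rfl
  unfold extendedAngle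
  split_ifs with h1 h2
  · exact (triangleAngle_eq_pi (oppositeExp_pos _ _) (oppositeExp_pos _ _) h1).symm
  · rcases h2 with h2 | h2
    · rw [degenerateRegion, mem_ofPred_eq, h6, h3] at h2
      exact (triangleAngle_eq_zero' (oppositeExp_pos _ _) (oppositeExp_pos _ _)
        (oppositeExp_pos _ _) (by linarith)).symm
    · rw [degenerateRegion, mem_ofPred_eq, h4, h5] at h2
      exact (triangleAngle_eq_zero (oppositeExp_pos _ _) (oppositeExp_pos _ _)
        (oppositeExp_pos _ _) (by linarith)).symm
  · refine dihedralAngle_eq_lawAngle (mem_tetAdmissible_iff.2 ?_) n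
    simp only [degenerateRegion, mem_union, mem_ofPred_eq, not_or, not_le, h6, h3, h4, h5] at h1 h2
    exact forall_oppositeExp_lt ℓ n h1 (by linarith [h2.1]) (by linarith [h2.2])

/-! ### Monotonicity of the angles of a tetrahedron -/

/-- Half the difference of the length sums of the pairs of opposite edges containing the `n`-th
edge and edge `2`.  For `n = 0, 1` these are the coordinates of `v` on which the angles depend. -/
noncomputable def oppositeDiff (n : Fin 6) (v : Fin 6 → ℝ) : ℝ :=
  (v n + v (n + 3)) / 2 - (v 2 + v 5) / 2

theorem lawAngle_add_three (ℓ : Fin 6 → ℝ) (n : Fin 6) : lawAngle ℓ (n + 3) = lawAngle ℓ n := by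
  unfold lawAngle
  rw [add_right_comm n 3 1, add_right_comm n 3 2, oppositeExp_add_three, oppositeExp_add_three,
    oppositeExp_add_three]

theorem lawAngle_zero_add_one_add_two (ℓ : Fin 6 → ℝ) :
    lawAngle ℓ 0 + lawAngle ℓ 1 + lawAngle ℓ 2 = Real.pi := by
  have h := triangleAngle_add_add (oppositeExp_pos ℓ 0) (oppositeExp_pos ℓ 1) (oppositeExp_pos ℓ 2)
  have e3 : oppositeExp ℓ 3 = oppositeExp ℓ 0 := oppositeExp_add_three ℓ 0
  have e4 : oppositeExp ℓ 4 = oppositeExp ℓ 1 := oppositeExp_add_three ℓ 1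
  change triangleAngle (oppositeExp ℓ 0) (oppositeExp ℓ 1) (oppositeExp ℓ 2) +
    triangleAngle (oppositeExp ℓ 1) (oppositeExp ℓ 2) (oppositeExp ℓ 3) +
    triangleAngle (oppositeExp ℓ 2) (oppositeExp ℓ 3) (oppositeExp ℓ 4) = Real.pi
  rw [e3, e4, h]

theorem oppositeExp_eq_mul_exp (ℓ : Fin 6 → ℝ) (n : Fin 6) :
    oppositeExp ℓ n = oppositeExp ℓ 2 * Real.exp (oppositeDiff n ℓ) := by
  unfold oppositeExp oppositeDiff
  rw [← Real.exp_add]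
  congr 1
  change _ = (ℓ 2 + ℓ 5) / 2 + _
  ring

theorem lawAngle_zero (ℓ : Fin 6 → ℝ) :
    lawAngle ℓ 0 = logAngle (oppositeDiff 0 ℓ) (oppositeDiff 1 ℓ) := by
  unfold logAngle
  rw [← triangleAngle_mul (oppositeExp_pos ℓ 2).ne', ← oppositeExp_eq_mul_exp,
    ← oppositeExp_eq_mul_exp,
    mul_one]
  rfl

theorem lawAngle_one (ℓ : Fin 6 → ℝ) :
    lawAngle ℓ 1 = logAngle (oppositeDiff 1 ℓ) (oppositeDiff 0 ℓ) := by
  unfold logAngle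
  rw [← triangleAngle_mul (oppositeExp_pos ℓ 2).ne', ← oppositeExp_eq_mul_exp,
    ← oppositeExp_eq_mul_exp,
    mul_one, triangleAngle_comm, ← oppositeExp_add_three ℓ 0]
  rfl

theorem oppositeDiff_add (n : Fin 6) (ℓ v : Fin 6 → ℝ) :
    oppositeDiff n (ℓ + v) = oppositeDiff n ℓ + oppositeDiff n v := by
  simp only [oppositeDiff, Pi.add_apply]; ring

theorem sum_lawAngle_mul (ℓ v : Fin 6 → ℝ) :
    ∑ n, lawAngle ℓ n * v n = 2 * (lawAngle ℓ 0 * oppositeDiff 0 v +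
      lawAngle ℓ 1 * oppositeDiff 1 v) + Real.pi * (v 2 + v 5) := by
  have h3 : lawAngle ℓ 3 = lawAngle ℓ 0 := lawAngle_add_three ℓ 0
  have h4 : lawAngle ℓ 4 = lawAngle ℓ 1 := lawAngle_add_three ℓ 1
  have h5 : lawAngle ℓ 5 = lawAngle ℓ 2 := lawAngle_add_three ℓ 2
  have e0 : oppositeDiff 0 v = (v 0 + v 3) / 2 - (v 2 + v 5) / 2 := rfl
  have e1 : oppositeDiff 1 v = (v 1 + v 4) / 2 - (v 2 + v 5) / 2 := rfl
  rw [Fin.sum_univ_six, h3, h4, h5, e0, e1, ← lawAngle_zero_add_one_add_two ℓ]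
  ring

theorem sum_lawAngle_sub_mul (ℓ v : Fin 6 → ℝ) :
    ∑ n, (lawAngle (ℓ + v) n - lawAngle ℓ n) * v n =
      2 * ((logAngle (oppositeDiff 0 ℓ + oppositeDiff 0 v) (oppositeDiff 1 ℓ + oppositeDiff 1 v) -
          logAngle (oppositeDiff 0 ℓ) (oppositeDiff 1 ℓ)) * oppositeDiff 0 v +
        (logAngle (oppositeDiff 1 ℓ + oppositeDiff 1 v) (oppositeDiff 0 ℓ + oppositeDiff 0 v) -
          logAngle (oppositeDiff 1 ℓ) (oppositeDiff 0 ℓ)) * oppositeDiff 1 v) := by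
  simp only [sub_mul, Finset.sum_sub_distrib, sum_lawAngle_mul, lawAngle_zero, lawAngle_one,
    oppositeDiff_add]
  ring

theorem sum_lawAngle_sub_mul_nonneg (ℓ v : Fin 6 → ℝ) :
    0 ≤ ∑ n, (lawAngle (ℓ + v) n - lawAngle ℓ n) * v n := by
  rw [sum_lawAngle_sub_mul]
  exact mul_nonneg zero_le_two (logAngle_monotone _ _ _ _)

theorem exists_lawAngle_strongly_monotone {ℓ : Fin 6 → ℝ} (h : ℓ ∈ tetAdmissible) {R : ℝ}
    (hR : 0 < R) : ∃ c, 0 < c ∧ ∀ v, |oppositeDiff 0 v| ≤ R → |oppositeDiff 1 v| ≤ R →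
      c * (oppositeDiff 0 v ^ 2 + oppositeDiff 1 v ^ 2) ≤
        ∑ n, (lawAngle (ℓ + v) n - lawAngle ℓ n) * v n := by
  have h' := mem_tetAdmissible_iff.1 h
  have hX2 := oppositeExp_pos ℓ 2
  have g0 : oppositeExp ℓ 0 < oppositeExp ℓ 1 + oppositeExp ℓ 2 := h' 0
  have g1 : oppositeExp ℓ 1 < oppositeExp ℓ 2 + oppositeExp ℓ 0 :=
    oppositeExp_add_three ℓ 0 ▸ h' 1
  have g2 : oppositeExp ℓ 2 < oppositeExp ℓ 0 + oppositeExp ℓ 1 :=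
    oppositeExp_add_three ℓ 0 ▸ oppositeExp_add_three ℓ 1 ▸ h' 2
  rw [oppositeExp_eq_mul_exp ℓ 0, oppositeExp_eq_mul_exp ℓ 1] at g0 g1 g2
  obtain ⟨c, hc, H⟩ := exists_logAngle_strongly_monotone (u := oppositeDiff 0 ℓ)
    (v := oppositeDiff 1 ℓ) (heron_pos (Real.exp_pos _) (Real.exp_pos _)
      (lt_of_mul_lt_mul_left (by linarith) hX2.le) (lt_of_mul_lt_mul_left (by linarith) hX2.le)
      (lt_of_mul_lt_mul_left (by linarith) hX2.le)) hR
  refine ⟨2 * c, by positivity, fun v h0 h1 => ?_⟩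
  rw [sum_lawAngle_sub_mul]
  linarith [H _ _ h0 h1]

/-- A change of the lengths by a vector with equal sums over opposite edges is a similarity of the
cross sections. -/
theorem exists_oppositeExp_add_eq (ℓ : Fin 6 → ℝ) {v : Fin 6 → ℝ} (h0 : oppositeDiff 0 v = 0)
    (h1 : oppositeDiff 1 v = 0) :
    ∃ k : ℝ, 0 < k ∧ ∀ n, oppositeExp (ℓ + v) n = k * oppositeExp ℓ n := by
  refine ⟨oppositeExp v 2, oppositeExp_pos _ _, fun n => ?_⟩
  have hn : oppositeDiff n v = 0 := by
    have e : ∀ m, oppositeDiff (m + 3) v = oppositeDiff m v := fun m => by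
      unfold oppositeDiff
      rw [add_assoc, show (3 : Fin 6) + 3 = 0 from rfl, add_zero, add_comm (v m)]
    have h2 : oppositeDiff 2 v = 0 := sub_self _
    fin_cases n
    · exact h0
    · exact h1
    · exact h2
    · exact (e 0).trans h0
    · exact (e 1).trans h1
    · exact (e 2).trans h2
  have hv : oppositeExp v n = oppositeExp v 2 := by
    rw [oppositeExp_eq_mul_exp, hn, Real.exp_zero, mul_one]
  rw [← hv, oppositeExp, oppositeExp, oppositeExp, ← Real.exp_add]
  congr 1
  simp only [Pi.add_apply]; ring

theorem lawAngle_add_eq (ℓ : Fin 6 → ℝ) {v : Fin 6 → ℝ} (h0 : oppositeDiff 0 v = 0)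
    (h1 : oppositeDiff 1 v = 0) : lawAngle (ℓ + v) = lawAngle ℓ := by
  obtain ⟨k, hk, h⟩ := exists_oppositeExp_add_eq ℓ h0 h1
  funext n
  unfold lawAngle
  rw [h, h, h, triangleAngle_mul hk.ne']

theorem add_mem_tetAdmissible {ℓ v : Fin 6 → ℝ} (h : ℓ ∈ tetAdmissible)
    (h0 : oppositeDiff 0 v = 0) (h1 : oppositeDiff 1 v = 0) : ℓ + v ∈ tetAdmissible := by
  obtain ⟨k, hk, hX⟩ := exists_oppositeExp_add_eq ℓ h0 h1
  rw [mem_tetAdmissible_iff] at h ⊢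
  intro n
  rw [hX, hX, hX, ← mul_add]
  exact mul_lt_mul_of_pos_left (h n) hk

theorem continuous_lawAngle (n : Fin 6) : Continuous fun ℓ => lawAngle ℓ n := by
  unfold lawAngle oppositeExp
  exact continuous_triangleAngle_comp (by fun_prop) (by fun_prop) (by fun_prop)
    (fun x => (Real.exp_pos _).ne') (fun x => (Real.exp_pos _).ne')

/-! ### The extended curvature of a triangulation -/

namespace IdealTriangulation

variable {T : Type*} (𝒯 : IdealTriangulation T)

theorem tetLengths_add (l v : 𝒯.Edge → ℝ) (t : T) :
    𝒯.tetLengths (l + v) t = 𝒯.tetLengths l t + 𝒯.tetLengths v t := rfl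

theorem add_mem_polyhedralMetrics {v : 𝒯.Edge → ℝ}
    (h0 : ∀ t, oppositeDiff 0 (𝒯.tetLengths v t) = 0)
    (h1 : ∀ t, oppositeDiff 1 (𝒯.tetLengths v t) = 0) {l : 𝒯.Edge → ℝ}
    (hl : l ∈ 𝒯.polyhedralMetrics) : l + v ∈ 𝒯.polyhedralMetrics := fun t =>
  add_mem_tetAdmissible (hl t) (h0 t) (h1 t)

variable [Fintype T]

theorem extendedRicci_eq_ricci {l : 𝒯.Edge → ℝ} (h : l ∈ 𝒯.polyhedralMetrics) (e : 𝒯.Edge) :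
    𝒯.extendedRicci l e = 𝒯.ricci l e := by
  unfold extendedRicci ricci
  congr 1
  refine Finset.sum_congr rfl fun a _ => ?_
  rw [extendedAngle_eq_lawAngle, dihedralAngle_eq_lawAngle (h a.1)]

theorem continuous_extendedRicci : Continuous 𝒯.extendedRicci := by
  refine continuous_pi fun e => ?_
  unfold extendedRicci
  simp only [extendedAngle_eq_lawAngle]
  refine continuous_const.sub (continuous_finsetSum _ fun a _ => ?_)
  exact (continuous_lawAngle a.2).comp (continuous_pi fun n => continuous_apply _)

theorem exists_norm_extendedRicci_le : ∃ M, ∀ l, ‖𝒯.extendedRicci l‖ ≤ M := by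
  classical
  have hM : 0 ≤ 2 * Real.pi + Fintype.card (T × Fin 6) * Real.pi := by positivity
  refine ⟨2 * Real.pi + Fintype.card (T × Fin 6) * Real.pi, fun l =>
    (pi_norm_le_iff_of_nonneg hM).2 fun e => ?_⟩
  unfold extendedRicci
  refine (norm_sub_le _ _).trans (add_le_add ?_ ((norm_sum_le _ _).trans ?_))
  · rw [Real.norm_eq_abs, abs_of_pos Real.two_pi_pos]
  · have h1 : ∀ a ∈ Finset.univ.filter (fun a : T × Fin 6 => 𝒯.edge a.1 a.2 = e),
        ‖extendedAngle (𝒯.tetLengths l a.1) a.2‖ ≤ Real.pi := fun a _ => by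
      rw [extendedAngle_eq_lawAngle, Real.norm_eq_abs, lawAngle, triangleAngle,
        abs_of_nonneg (Real.arccos_nonneg _)]
      exact Real.arccos_le_pi _
    refine (Finset.sum_le_card_nsmul _ _ _ h1).trans ?_
    rw [nsmul_eq_mul]
    exact mul_le_mul_of_nonneg_right (by exact_mod_cast Finset.card_filter_le _ _)
      Real.pi_pos.le

/-- Summation over the edges is summation over the edges of all tetrahedra. -/
theorem extendedRicci_dotProduct (l v : 𝒯.Edge → ℝ) :
    𝒯.extendedRicci l ⬝ᵥ v = 2 * Real.pi * ∑ e, v e -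
      ∑ t, ∑ n, lawAngle (𝒯.tetLengths l t) n * 𝒯.tetLengths v t n := by
  classical
  rw [← Fintype.sum_prod_type', ← Finset.sum_fiberwise (g := fun a : T × Fin 6 => 𝒯.edge a.1 a.2),
    Finset.mul_sum, ← Finset.sum_sub_distrib]
  refine Finset.sum_congr rfl fun e _ => ?_
  unfold extendedRicci
  simp only [extendedAngle_eq_lawAngle]
  rw [sub_mul, Finset.sum_mul]
  congr 1
  refine Finset.sum_congr (by congr) fun a ha => ?_
  rw [← (Finset.mem_filter.1 ha).2]
  rfl

theorem extendedRicci_sub_dotProduct (l v : 𝒯.Edge → ℝ) :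
    (𝒯.extendedRicci (l + v) - 𝒯.extendedRicci l) ⬝ᵥ v = -∑ t, ∑ n,
      (lawAngle (𝒯.tetLengths l t + 𝒯.tetLengths v t) n - lawAngle (𝒯.tetLengths l t) n) *
        𝒯.tetLengths v t n := by
  simp only [sub_dotProduct, extendedRicci_dotProduct, tetLengths_add, sub_mul,
    Finset.sum_sub_distrib]
  ring

theorem isDissipative_extendedRicci : IsDissipative 𝒯.extendedRicci := by
  intro x y
  have h := 𝒯.extendedRicci_sub_dotProduct y (x - y)
  rw [add_sub_cancel] at h
  rw [h]
  exact neg_nonpos.2 (Finset.sum_nonneg fun t _ => sum_lawAngle_sub_mul_nonneg _ _)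

/-- The squared size of a deformation `v` of the lengths modulo similarities of the cross sections
of the tetrahedra. -/
noncomputable def shapeEnergy (v : 𝒯.Edge → ℝ) : ℝ :=
  ∑ t, (oppositeDiff 0 (𝒯.tetLengths v t) ^ 2 + oppositeDiff 1 (𝒯.tetLengths v t) ^ 2)

theorem abs_oppositeDiff_tetLengths_le (v : 𝒯.Edge → ℝ) (t : T) (n : Fin 6) :
    |oppositeDiff n (𝒯.tetLengths v t)| ≤ 2 * ‖v‖ := by
  have h : ∀ m, |𝒯.tetLengths v t m| ≤ ‖v‖ := fun m => norm_le_pi_norm v _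
  have h1 := abs_le.1 (h n)
  have h2 := abs_le.1 (h (n + 3))
  have h3 := abs_le.1 (h 2)
  have h4 := abs_le.1 (h 5)
  unfold oppositeDiff
  rw [abs_le]
  constructor <;> linarith

/-- Strong monotonicity of the curvature at a polyhedral metric, modulo similarities of the cross
sections. -/
theorem exists_extendedRicci_strongly_monotone {l : 𝒯.Edge → ℝ} (hl : l ∈ 𝒯.polyhedralMetrics)
    {R : ℝ} (hR : 0 < R) : ∃ c, 0 < c ∧ ∀ v, ‖v‖ ≤ R →
      (𝒯.extendedRicci (l + v) - 𝒯.extendedRicci l) ⬝ᵥ v ≤ -(c * 𝒯.shapeEnergy v) := by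
  choose c hc H using fun t => exists_lawAngle_strongly_monotone (hl t)
    (show 0 < 2 * R by positivity)
  obtain ⟨c₀, hc₀, hle⟩ : ∃ c₀, 0 < c₀ ∧ ∀ t, c₀ ≤ c t := by
    rcases isEmpty_or_nonempty T with hT | hT
    · exact ⟨1, one_pos, fun t => hT.elim t⟩
    · obtain ⟨t₀, ht₀⟩ := Finite.exists_min c
      exact ⟨c t₀, hc t₀, ht₀⟩
  refine ⟨c₀, hc₀, fun v hv => ?_⟩
  rw [extendedRicci_sub_dotProduct, neg_le_neg_iff, shapeEnergy, Finset.mul_sum]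
  refine Finset.sum_le_sum fun t _ => ?_
  have hb := fun n => (𝒯.abs_oppositeDiff_tetLengths_le v t n).trans
    (show 2 * ‖v‖ ≤ 2 * R by linarith)
  exact (mul_le_mul_of_nonneg_right (hle t) (by positivity)).trans (H t _ (hb 0) (hb 1))

/-! ### Changes of decoration -/

theorem cuspMatrix_transpose_mulVec_edge (x : 𝒯.Cusp → ℝ) (t : T) (n : Fin 6) :
    (𝒯.cuspMatrixᵀ *ᵥ x) (𝒯.edge t n) =
      x (𝒯.cusp t (edgeFst n)) + x (𝒯.cusp t (edgeSnd n)) := by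
  classical
  have h : ∀ p, 𝒯.cuspMatrixᵀ (𝒯.edge t n) p =
      (if 𝒯.cusp t (edgeFst n) = p then 1 else 0) +
        (if 𝒯.cusp t (edgeSnd n) = p then 1 else 0) := by
    intro p
    change ((𝒯.numEnds p (𝒯.edge t n) : ℕ) : ℝ) = _
    change ((_ + _ : ℕ) : ℝ) = _
    push_cast
    congr
  simp only [mulVec, dotProduct, h, add_mul, ite_mul, one_mul, zero_mul, Finset.sum_add_distrib,
    Finset.sum_ite_eq, Finset.mem_univ, if_true]

theorem oppositeDiff_tetLengths_transpose_mulVec (x : 𝒯.Cusp → ℝ) (t : T) (n : Fin 6) :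
    oppositeDiff n (𝒯.tetLengths (𝒯.cuspMatrixᵀ *ᵥ x) t) = 0 := by
  simp only [oppositeDiff, tetLengths, cuspMatrix_transpose_mulVec_edge]
  fin_cases n <;> simp [edgeFst, edgeSnd] <;> ring

theorem extendedRicci_add_of_oppositeDiff {v : 𝒯.Edge → ℝ}
    (h0 : ∀ t, oppositeDiff 0 (𝒯.tetLengths v t) = 0)
    (h1 : ∀ t, oppositeDiff 1 (𝒯.tetLengths v t) = 0) (l : 𝒯.Edge → ℝ) :
    𝒯.extendedRicci (l + v) = 𝒯.extendedRicci l := by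
  funext e
  unfold extendedRicci
  simp only [extendedAngle_eq_lawAngle, tetLengths_add, lawAngle_add_eq _ (h0 _) (h1 _)]

/-- Around each cusp the angles of the link add up to `π` times the number of its triangles, and the
link is a torus: the curvature is orthogonal to the changes of decoration. -/
theorem cuspMatrix_mulVec_extendedRicci (h𝒯 : 𝒯.IsCusped) (l : 𝒯.Edge → ℝ) :
    𝒯.cuspMatrix *ᵥ 𝒯.extendedRicci l = 0 := by
  classical
  funext p
  have hE : ∀ e, (𝒯.cuspMatrixᵀ *ᵥ Pi.single p 1) e = 𝒯.numEnds p e := fun e => by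
    simp [cuspMatrix]
  have h1 : (𝒯.cuspMatrix *ᵥ 𝒯.extendedRicci l) p =
      𝒯.extendedRicci l ⬝ᵥ (𝒯.cuspMatrixᵀ *ᵥ Pi.single p 1) := by
    rw [dotProduct_comm]
    simp only [dotProduct, hE]
    rfl
  rw [h1, extendedRicci_dotProduct]
  simp only [tetLengths, hE]
  have hS : (∑ e : 𝒯.Edge, (𝒯.numEnds p e : ℝ)) =
      (Finset.univ.filter fun a : T × Fin 4 => 𝒯.cusp a.1 a.2 = p).card / 2 := by
    have h : (∑ e : 𝒯.Edge, (𝒯.numEnds p e : ℚ)) -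
        3 * ((Finset.univ.filter fun a : T × Fin 4 => 𝒯.cusp a.1 a.2 = p).card : ℚ) / 2 +
        ((Finset.univ.filter fun a : T × Fin 4 => 𝒯.cusp a.1 a.2 = p).card : ℚ) = 0 := h𝒯 p
    have h' := congrArg (fun q : ℚ => (q : ℝ)) h
    push_cast at h'
    linarith
  have hcard : ((Finset.univ.filter fun a : T × Fin 4 => 𝒯.cusp a.1 a.2 = p).card : ℝ) =
      ∑ t, ∑ i : Fin 4, (Pi.single p 1 : 𝒯.Cusp → ℝ) (𝒯.cusp t i) := by
    rw [← Fintype.sum_prod_type', Finset.card_filter]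
    push_cast
    exact Finset.sum_congr rfl fun a _ => by rw [Pi.single_apply]
  have htet : ∀ t, ∑ n, lawAngle (𝒯.tetLengths l t) n * 𝒯.numEnds p (𝒯.edge t n) =
      Real.pi * ∑ i : Fin 4, (Pi.single p 1 : 𝒯.Cusp → ℝ) (𝒯.cusp t i) := by
    intro t
    simp only [← hE, cuspMatrix_transpose_mulVec_edge]
    generalize 𝒯.tetLengths l t = ℓ
    have h3 : lawAngle ℓ 3 = lawAngle ℓ 0 := lawAngle_add_three ℓ 0
    have h4 : lawAngle ℓ 4 = lawAngle ℓ 1 := lawAngle_add_three ℓ 1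
    have h5 : lawAngle ℓ 5 = lawAngle ℓ 2 := lawAngle_add_three ℓ 2
    rw [Fin.sum_univ_six, Fin.sum_univ_four, h3, h4, h5, ← lawAngle_zero_add_one_add_two ℓ]
    simp only [edgeFst, edgeSnd, cons_val]
    ring
  rw [Finset.sum_congr rfl fun t _ => htet t, ← Finset.mul_sum, hS, hcard, Pi.zero_apply]
  ring

/-- A deformation of the lengths that is a similarity on the cross sections of all tetrahedra is a
change of decoration: on a tetrahedron it has the form `v_ij = w_i + w_j`, and `w_i` is determined
by any face at `i`, so that it only depends on the cusp. -/
theorem exists_transpose_mulVec_eq {v : 𝒯.Edge → ℝ}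
    (h0 : ∀ t, oppositeDiff 0 (𝒯.tetLengths v t) = 0)
    (h1 : ∀ t, oppositeDiff 1 (𝒯.tetLengths v t) = 0) :
    ∃ w : 𝒯.Cusp → ℝ, v = 𝒯.cuspMatrixᵀ *ᵥ w := by
  let V : T → Fin 6 → ℝ := 𝒯.tetLengths v
  let W : T → Fin 4 → ℝ := fun t => ![(V t 0 + V t 1 - V t 5) / 2, (V t 0 + V t 5 - V t 1) / 2,
    (V t 1 + V t 5 - V t 0) / 2, (V t 2 + V t 4 - V t 0) / 2]
  have hW : ∀ t n, W t (edgeFst n) + W t (edgeSnd n) = V t n := by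
    intro t n
    have e0 : (V t 0 + V t 3) / 2 - (V t 2 + V t 5) / 2 = 0 := h0 t
    have e1 : (V t 1 + V t 4) / 2 - (V t 2 + V t 5) / 2 = 0 := h1 t
    fin_cases n <;> simp [W, edgeFst, edgeSnd] <;> linarith
  have hedge : ∀ i j : Fin 4, i ≠ j → ∃ n, s(edgeFst n, edgeSnd n) = s(i, j) := by decide
  have hW' : ∀ t n i j, s(edgeFst n, edgeSnd n) = s(i, j) → W t i + W t j = V t n := by
    intro t n i j h
    rcases Sym2.eq_iff.1 h with ⟨rfl, rfl⟩ | ⟨rfl, rfl⟩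
    · exact hW t n
    · rw [add_comm]; exact hW t n
  have hpair : ∀ t f i j, i ≠ j → f ≠ i → f ≠ j →
      W (𝒯.adj t f) (𝒯.glue t f i) + W (𝒯.adj t f) (𝒯.glue t f j) = W t i + W t j := by
    intro t f i j hij hi hj
    obtain ⟨n, hn⟩ := hedge i j hij
    obtain ⟨m, hm⟩ := hedge (𝒯.glue t f i) (𝒯.glue t f j) ((𝒯.glue t f).injective.ne hij)
    rw [hW' _ _ _ _ hn, hW' _ _ _ _ hm]
    refine congrArg v (Quot.sound ⟨f, ?_, ?_, rfl, ?_⟩).symm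
    · rcases Sym2.eq_iff.1 hn with ⟨h, -⟩ | ⟨h, -⟩ <;> rw [h] <;> assumption
    · rcases Sym2.eq_iff.1 hn with ⟨-, h⟩ | ⟨-, h⟩ <;> rw [h] <;> assumption
    · rw [hm]
      rcases Sym2.eq_iff.1 hn with ⟨h, h'⟩ | ⟨h, h'⟩ <;> rw [h, h']
      exact Sym2.eq_swap
  have hface : ∀ f i : Fin 4, f ≠ i → ∃ j k, f ≠ j ∧ f ≠ k ∧ i ≠ j ∧ i ≠ k ∧ j ≠ k := by decide
  have hglue : ∀ a b, 𝒯.VertexRel a b → W a.1 a.2 = W b.1 b.2 := by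
    rintro ⟨t, i⟩ _ ⟨f, hf, rfl⟩
    obtain ⟨j, k, hj, hk, hij, hik, hjk⟩ := hface f i hf
    have e1 := hpair t f i j hij hf hj
    have e2 := hpair t f i k hik hf hk
    have e3 := hpair t f j k hjk hj hk
    simp only
    linarith
  refine ⟨Quot.lift (fun a => W a.1 a.2) hglue, funext fun e => ?_⟩
  induction e using Quot.ind with
  | mk a =>
    refine Eq.trans ?_ (𝒯.cuspMatrix_transpose_mulVec_edge _ a.1 a.2).symm
    exact (hW a.1 a.2).symm

/-- The shape energy is positive definite on the kernel of the cusp relation matrix. -/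
theorem exists_mul_dotProduct_le_shapeEnergy : ∃ c, 0 < c ∧ ∀ v : 𝒯.Edge → ℝ,
    𝒯.cuspMatrix *ᵥ v = 0 → c * (v ⬝ᵥ v) ≤ 𝒯.shapeEnergy v := by
  let ψ : (𝒯.Edge → ℝ) →ₗ[ℝ] (T → ℝ × ℝ) :=
    { toFun := fun v t => (oppositeDiff 0 (𝒯.tetLengths v t), oppositeDiff 1 (𝒯.tetLengths v t))
      map_add' := fun v w => by
        funext t
        simp only [tetLengths_add, oppositeDiff_add, Pi.add_apply, Prod.mk_add_mk]
      map_smul' := fun c v => by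
        funext t
        simp only [oppositeDiff, tetLengths, Pi.smul_apply, smul_eq_mul, RingHom.id_apply,
          Prod.smul_mk, Prod.mk.injEq]
        constructor <;> ring }
  let φ := ψ.comp (LinearMap.ker 𝒯.cuspMatrix.mulVecLin).subtype
  have hker : LinearMap.ker φ = ⊥ := by
    rw [LinearMap.ker_eq_bot']
    rintro ⟨v, hv⟩ h
    have hv' : 𝒯.cuspMatrix *ᵥ v = 0 := hv
    have h' : ∀ t, ((oppositeDiff 0 (𝒯.tetLengths v t), oppositeDiff 1 (𝒯.tetLengths v t)) : ℝ × ℝ)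
      = 0 := fun t => congrFun h t
    obtain ⟨w, hw⟩ := 𝒯.exists_transpose_mulVec_eq (fun t => congrArg Prod.fst (h' t))
      (fun t => congrArg Prod.snd (h' t))
    have h0 : v ⬝ᵥ v = 0 := by
      nth_rw 2 [hw]
      rw [dotProduct_transpose_mulVec, hv', dotProduct_zero]
    exact Subtype.ext (dotProduct_self_eq_zero.1 h0)
  obtain ⟨K, hK, hanti⟩ := φ.exists_antilipschitzWith hker
  have hKpos : 0 < (K : ℝ) := hK
  refine ⟨1 / ((Fintype.card 𝒯.Edge + 1) * K ^ 2), by positivity, fun v hv => ?_⟩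
  have hE0 : 0 ≤ 𝒯.shapeEnergy v := Finset.sum_nonneg fun t _ => by positivity
  have h1 : ‖v‖ ≤ K * ‖ψ v‖ := by
    have := hanti.le_mul_norm_sub (⟨v, hv⟩ : LinearMap.ker 𝒯.cuspMatrix.mulVecLin) 0
    rwa [add_zero, map_zero, add_zero, norm_neg, norm_neg] at this
  have h2 : ‖ψ v‖ ≤ Real.sqrt (𝒯.shapeEnergy v) := by
    refine (pi_norm_le_iff_of_nonneg (Real.sqrt_nonneg _)).2 fun t => ?_
    have ht : oppositeDiff 0 (𝒯.tetLengths v t) ^ 2 + oppositeDiff 1 (𝒯.tetLengths v t) ^ 2 ≤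
        𝒯.shapeEnergy v := Finset.single_le_sum (f := fun t =>
          oppositeDiff 0 (𝒯.tetLengths v t) ^ 2 + oppositeDiff 1 (𝒯.tetLengths v t) ^ 2)
          (fun t _ => by positivity) (Finset.mem_univ t)
    refine max_le ?_ ?_
    · exact Real.abs_le_sqrt ((le_add_of_nonneg_right (sq_nonneg _)).trans ht)
    · exact Real.abs_le_sqrt ((le_add_of_nonneg_left (sq_nonneg _)).trans ht)
  have h3 : ‖v‖ * ‖v‖ ≤ K ^ 2 * 𝒯.shapeEnergy v := by
    have h4 := h1.trans (mul_le_mul_of_nonneg_left h2 hKpos.le)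
    have h5 := mul_le_mul h4 h4 (norm_nonneg _) (by positivity)
    rw [mul_mul_mul_comm, Real.mul_self_sqrt hE0] at h5
    rwa [sq (K : ℝ)]
  have h6 := (le_abs_self _).trans (abs_dotProduct_le_card_mul_norm v v)
  rw [div_mul_eq_mul_div, one_mul, div_le_iff₀ (by positivity)]
  have h7 := mul_le_mul_of_nonneg_left h3 (Nat.cast_nonneg (α := ℝ) (Fintype.card 𝒯.Edge))
  nlinarith [mul_nonneg (sq_nonneg (K : ℝ)) hE0]

end IdealTriangulation

namespace IdealTriangulation

variable {T : Type*} {𝒯 : IdealTriangulation T} {z : T → ℂ}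

/-! ### Developing the links of the cusps -/

namespace LinkTransport

theorem trans {a b d : T × Equiv.Perm (Fin 4)} {c c' : ℂ} (h : 𝒯.LinkTransport z a b c)
    (h' : 𝒯.LinkTransport z b d c') : 𝒯.LinkTransport z a d (c' * c) := by
  induction h' with
  | refl => rwa [one_mul]
  | turn t σ c' n _ hn ih => rw [mul_assoc]; exact .turn t σ _ n ih hn
  | flip t σ c' _ ih => rw [neg_mul]; exact .flip t σ _ ih
  | cross t σ c' _ ih => exact .cross t σ _ ih

theorem ne_zero (hz : ∀ t n, shapeAt (z t) n ≠ 0) {a b : T × Equiv.Perm (Fin 4)} {c : ℂ}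
    (h : 𝒯.LinkTransport z a b c) : c ≠ 0 := by
  induction h with
  | refl => exact one_ne_zero
  | turn t σ c n _ hn ih => exact mul_ne_zero (zpow_ne_zero _ (hz t n)) ih
  | flip t σ c _ ih => exact neg_ne_zero.2 ih
  | cross t σ c _ ih => exact ih

theorem symm {a b : T × Equiv.Perm (Fin 4)} {c : ℂ}
    (h : 𝒯.LinkTransport z a b c) : 𝒯.LinkTransport z b a c⁻¹ := by
  induction h with
  | refl => rw [inv_one]; exact .refl
  | turn t σ c n h hn ih =>
    have h1 : 𝒯.LinkTransport z (t, σ * Equiv.swap 2 3) (t, σ)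
        (shapeAt (z t) n ^ (Equiv.Perm.sign σ : ℤ))⁻¹ := by
      have h2 := LinkTransport.turn (𝒯 := 𝒯) (z := z) (a := (t, σ * Equiv.swap 2 3)) t
        (σ * Equiv.swap 2 3) 1 n .refl (by rw [hn]; rfl)
      rw [mul_assoc, Equiv.swap_mul_self, mul_one, mul_one, Equiv.Perm.sign_mul,
        Equiv.Perm.sign_swap (by decide)] at h2
      simpa using h2
    rw [mul_inv, mul_comm]
    exact h1.trans ih
  | flip t σ c h ih =>
    have h2 := LinkTransport.flip (𝒯 := 𝒯) (z := z) (a := (t, σ * Equiv.swap 1 2)) t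
      (σ * Equiv.swap 1 2) 1 .refl
    rw [mul_assoc, Equiv.swap_mul_self, mul_one] at h2
    have h3 := h2.trans ih
    rwa [mul_neg_one, ← inv_neg] at h3
  | cross t σ c h ih =>
    have h2 := LinkTransport.cross (𝒯 := 𝒯) (z := z)
      (a := (𝒯.adj t (σ 3), 𝒯.glue t (σ 3) * σ)) (𝒯.adj t (σ 3)) (𝒯.glue t (σ 3) * σ) 1 .refl
    rw [Equiv.Perm.mul_apply, 𝒯.adj_adj, 𝒯.glue_glue, inv_mul_cancel_left] at h2
    have h3 := h2.trans ih
    rwa [mul_one] at h3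

end LinkTransport

/-- If the links have no holonomy, their triangles develop consistently: the oriented sides can be
given vectors that are compatible with the transport. -/
theorem exists_sideVector (hz : ∀ t n, shapeAt (z t) n ≠ 0)
    (hol : ∀ (a : T × Equiv.Perm (Fin 4)) (c : ℂ), 𝒯.LinkTransport z a a c → c = 1) :
    ∃ u : T × Equiv.Perm (Fin 4) → ℂ, (∀ a, u a ≠ 0) ∧
      ∀ a b c, 𝒯.LinkTransport z a b c → u b = c * u a := by
  let S : Setoid (T × Equiv.Perm (Fin 4)) :=
    { r := fun a b => ∃ c, 𝒯.LinkTransport z a b c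
      iseqv := ⟨fun _ => ⟨1, .refl⟩, fun ⟨_, h⟩ => ⟨_, h.symm⟩,
        fun ⟨_, h⟩ ⟨_, h'⟩ => ⟨_, h.trans h'⟩⟩ }
  have hrep : ∀ a, ∃ c, 𝒯.LinkTransport z (Quotient.mk S a).out a c := fun a => Quotient.mk_out a
  choose u hu using hrep
  refine ⟨u, fun a => (hu a).ne_zero hz, fun a b c h => ?_⟩
  have hq : Quotient.mk S a = Quotient.mk S b := Quotient.sound ⟨c, h⟩
  have hb := hu b
  rw [← hq] at hb
  have h1 := hol _ _ (((hu a).trans h).trans (hb.symm))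
  rw [inv_mul_eq_one₀ (hb.ne_zero hz)] at h1
  exact h1

/-! ### The decorated metric of a complete hyperbolic structure -/

theorem perm_eq_of_sym2_eq {π : Equiv.Perm (Fin 4)} (h : s(π 0, π 1) = s(0, 1)) :
    π = 1 ∨ π = Equiv.swap 0 1 ∨ π = Equiv.swap 2 3 ∨ π = Equiv.swap 2 3 * Equiv.swap 0 1 := by
  revert h; revert π; decide

theorem exists_perm_edge : ∀ n : Fin 6, ∃ σ : Equiv.Perm (Fin 4),
    σ 0 = edgeFst n ∧ σ 1 = edgeSnd n := by decide

theorem exists_perm_edge_face : ∀ (n : Fin 6) (f : Fin 4), f ≠ edgeFst n → f ≠ edgeSnd n →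
    ∃ σ : Equiv.Perm (Fin 4), σ 0 = edgeFst n ∧ σ 1 = edgeSnd n ∧ σ 3 = f := by decide

/-- If horospherical cross sections are chosen at the cusps such that the logarithms of the lengths
of the sides of the link triangles are `ρ`, then the signed length of the edge `ij` of a face `ijk`
is `-(ρ_i + ρ_j)`, where `ρ_i` and `ρ_j` belong to the horocyclic arcs of this face at `i` and `j`.
The hypotheses make this independent of the tetrahedron and the face. -/
theorem exists_length_of_sideLength {ρ : T → Equiv.Perm (Fin 4) → ℝ} {s : T → Fin 6 → ℝ}
    (hturn : ∀ t σ n, s(edgeFst n, edgeSnd n) = s(σ 0, σ 1) →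
      ρ t (σ * Equiv.swap 2 3) = (Equiv.Perm.sign σ : ℤ) * s t n + ρ t σ)
    (hcross : ∀ t σ, ρ (𝒯.adj t (σ 3)) (𝒯.glue t (σ 3) * σ) = ρ t σ) :
    ∃ l : 𝒯.Edge → ℝ, ∀ t n (σ : Equiv.Perm (Fin 4)), s(edgeFst n, edgeSnd n) = s(σ 0, σ 1) →
      l (𝒯.edge t n) = -(ρ t σ + ρ t (σ * Equiv.swap 0 1)) := by
  let L : T → Equiv.Perm (Fin 4) → ℝ := fun t σ => -(ρ t σ + ρ t (σ * Equiv.swap 0 1))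
  have hedge : ∀ i j : Fin 4, i ≠ j → ∃ n, s(edgeFst n, edgeSnd n) = s(i, j) := by decide
  have hcomm : (Equiv.swap 2 3 * Equiv.swap 0 1 : Equiv.Perm (Fin 4)) =
      Equiv.swap 0 1 * Equiv.swap 2 3 := by decide
  have h01 : ∀ t σ, L t (σ * Equiv.swap 0 1) = L t σ := fun t σ => by
    simp only [L]
    rw [mul_assoc, Equiv.swap_mul_self, mul_one, add_comm]
  have h23 : ∀ t σ, L t (σ * Equiv.swap 2 3) = L t σ := fun t σ => by
    obtain ⟨n, hn⟩ := hedge (σ 0) (σ 1) (σ.injective.ne (by decide))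
    simp only [L]
    rw [mul_assoc, hcomm, ← mul_assoc, hturn t σ n hn,
      hturn t (σ * Equiv.swap 0 1) n (hn.trans Sym2.eq_swap), Equiv.Perm.sign_mul,
      Equiv.Perm.sign_swap (by decide)]
    push_cast
    ring
  have hL : ∀ t (σ τ : Equiv.Perm (Fin 4)), s(σ 0, σ 1) = s(τ 0, τ 1) → L t σ = L t τ := by
    intro t σ τ h
    have h' : s((τ⁻¹ * σ) 0, (τ⁻¹ * σ) 1) = s(0, 1) := by
      have := congrArg (Sym2.map (τ⁻¹ : Equiv.Perm (Fin 4))) h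
      simpa using this
    have hσ : σ = τ * (τ⁻¹ * σ) := (mul_inv_cancel_left τ σ).symm
    rcases perm_eq_of_sym2_eq h' with h1 | h1 | h1 | h1 <;> rw [h1] at hσ <;> rw [hσ]
    · rw [mul_one]
    · exact h01 t τ
    · exact h23 t τ
    · rw [← mul_assoc, h01, h23]
  choose std hstd using exists_perm_edge
  refine ⟨Quot.lift (fun a => L a.1 (std a.2)) ?_, fun t n σ h => ?_⟩
  · rintro ⟨t, n⟩ ⟨t', m⟩ ⟨f, h1, h2, h3, h4⟩
    dsimp only at h1 h2 h3 h4 ⊢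
    subst h3
    obtain ⟨σ, e0, e1, e3⟩ := exists_perm_edge_face n f h1 h2
    have hc : L (𝒯.adj t f) (𝒯.glue t f * σ) = L t σ := by
      simp only [L]
      rw [← e3, hcross, mul_assoc]
      congr 2
      exact hcross t (σ * Equiv.swap 0 1)
    rw [hL t (std n) σ (by rw [(hstd n).1, (hstd n).2, e0, e1]), ← hc]
    refine hL _ _ _ ?_
    rw [(hstd m).1, (hstd m).2, h4, ← e0, ← e1]
    rfl
  · exact hL t _ _ (by rw [(hstd n).1, (hstd n).2, h])

theorem shapeAt_im_pos {z : ℂ} (hz : 0 < z.im) (n : Fin 6) : 0 < (shapeAt z n).im := by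
  have h0 : z ≠ 0 := fun h => by rw [h] at hz; simp at hz
  have h1 : 1 - z ≠ 0 := fun h => by
    have := congrArg Complex.im h
    simp at this; linarith
  have e1 : 0 < (1 / (1 - z)).im := by
    rw [one_div, Complex.inv_im]
    have := Complex.normSq_pos.2 h1
    simp only [Complex.sub_im, Complex.one_im, zero_sub, neg_neg]
    positivity
  have e2 : 0 < (1 - 1 / z).im := by
    rw [one_div, Complex.sub_im, Complex.inv_im]
    have := Complex.normSq_pos.2 h0
    simp only [Complex.one_im, zero_sub, neg_div, neg_neg]
    positivity
  fin_cases n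
  exacts [hz, e1, e2, hz, e1, e2]

theorem log_div_im_eq_triangleAngle {x y : ℂ} (hx : x ≠ 0) (hy : y ≠ 0) (h : 0 < (x / y).im) :
    (Complex.log (x / y)).im = triangleAngle ‖x - y‖ ‖x‖ ‖y‖ := by
  rw [Complex.log_im, ← angle_eq_triangleAngle, Complex.angle_eq_abs_arg hx hy,
    abs_of_nonneg (Complex.arg_nonneg_iff.2 h.le)]

/-- A decorated tetrahedron whose cross sections are similar to the triangle `0, 1, z` has the
dihedral angles of the ideal tetrahedron of shape `z`. -/
theorem lawAngle_eq_log_shapeAt_im {z : ℂ} (hz : 0 < z.im) {ℓ : Fin 6 → ℝ}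
    (h0 : oppositeDiff 0 ℓ = Real.log ‖z - 1‖) (h1 : oppositeDiff 1 ℓ = Real.log ‖z‖) :
    ℓ ∈ tetAdmissible ∧ ∀ n, lawAngle ℓ n = (Complex.log (shapeAt z n)).im := by
  have z0 : z ≠ 0 := fun h => by rw [h] at hz; simp at hz
  have z1 : z - 1 ≠ 0 := fun h => by
    have := congrArg Complex.im h
    simp at this; linarith
  have hX2 := oppositeExp_pos ℓ 2
  have X0 : oppositeExp ℓ 0 = oppositeExp ℓ 2 * ‖z - 1‖ := by
    rw [oppositeExp_eq_mul_exp, h0, Real.exp_log (norm_pos_iff.2 z1)]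
  have X1 : oppositeExp ℓ 1 = oppositeExp ℓ 2 * ‖z‖ := by
    rw [oppositeExp_eq_mul_exp, h1, Real.exp_log (norm_pos_iff.2 z0)]
  obtain ⟨g1, g2, g3⟩ := norm_triangle_strict hz.ne'
  refine ⟨mem_tetAdmissible_of_lt (forall_oppositeExp_lt ℓ 0 ?_ ?_ ?_), ?_⟩
  · change oppositeExp ℓ 0 < oppositeExp ℓ 1 + oppositeExp ℓ 2
    rw [X0, X1]; nlinarith
  · change oppositeExp ℓ 1 < oppositeExp ℓ 2 + oppositeExp ℓ 0
    rw [X0, X1]; nlinarith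
  · change oppositeExp ℓ 2 < oppositeExp ℓ 0 + oppositeExp ℓ 1
    rw [X0, X1]; nlinarith
  have hmul : ∀ a b c, triangleAngle (oppositeExp ℓ 2 * a) (oppositeExp ℓ 2 * b)
      (oppositeExp ℓ 2 * c) = triangleAngle a b c := triangleAngle_mul hX2.ne'
  have e3 : oppositeExp ℓ 3 = oppositeExp ℓ 0 := oppositeExp_add_three ℓ 0
  have e4 : oppositeExp ℓ 4 = oppositeExp ℓ 1 := oppositeExp_add_three ℓ 1
  have a0 : lawAngle ℓ 0 = (Complex.log z).im := by
    change triangleAngle (oppositeExp ℓ 0) (oppositeExp ℓ 1) (oppositeExp ℓ 2) = _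
    have h := log_div_im_eq_triangleAngle z0 one_ne_zero (by rwa [div_one])
    rw [div_one, norm_one, ← hmul, mul_one, ← X0, ← X1] at h
    exact h.symm
  have a1 : lawAngle ℓ 1 = (Complex.log (1 / (1 - z))).im := by
    change triangleAngle (oppositeExp ℓ 1) (oppositeExp ℓ 2) (oppositeExp ℓ 3) = _
    have h := log_div_im_eq_triangleAngle one_ne_zero (y := 1 - z) (by rwa [← neg_sub, neg_ne_zero])
      (shapeAt_im_pos hz 1)
    rw [sub_sub_cancel, norm_one, norm_sub_rev 1 z, ← hmul, mul_one, ← X0, ← X1] at h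
    rw [e3]
    exact h.symm
  have a2 : lawAngle ℓ 2 = (Complex.log (1 - 1 / z)).im := by
    change triangleAngle (oppositeExp ℓ 2) (oppositeExp ℓ 3) (oppositeExp ℓ 4) = _
    have hd : (z - 1) / z = 1 - 1 / z := by field_simp
    have h := log_div_im_eq_triangleAngle z1 z0 (by rw [hd]; exact shapeAt_im_pos hz 2)
    rw [hd, sub_sub_cancel_left, norm_neg, norm_one, ← hmul, mul_one, ← X0, ← X1] at h
    rw [e3, e4]
    exact h.symm
  intro n
  fin_cases n
  · exact a0
  · exact a1
  · exact a2
  · exact (lawAngle_add_three ℓ 0).trans a0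
  · exact (lawAngle_add_three ℓ 1).trans a1
  · exact (lawAngle_add_three ℓ 2).trans a2

/-- A complete hyperbolic structure, decorated by horospherical cross sections of the cusps, is a
polyhedral metric with zero curvature. -/
theorem HasCompleteHyperbolicMetric.exists_extendedRicci_eq_zero [Fintype T]
    (h : 𝒯.HasCompleteHyperbolicMetric) :
    ∃ l ∈ 𝒯.polyhedralMetrics, 𝒯.extendedRicci l = 0 := by
  obtain ⟨z, hz, hlog, hol⟩ := h
  have hz0 : ∀ t n, shapeAt (z t) n ≠ 0 := fun t n h => by
    have := shapeAt_im_pos (hz t) n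
    rw [h] at this; simp at this
  obtain ⟨u, hu0, hu⟩ := exists_sideVector hz0 hol
  let ρ : T → Equiv.Perm (Fin 4) → ℝ := fun t σ => Real.log ‖u (t, σ)‖
  have hturn : ∀ t σ n, s(edgeFst n, edgeSnd n) = s(σ 0, σ 1) →
      ρ t (σ * Equiv.swap 2 3) =
        (Equiv.Perm.sign σ : ℤ) * Real.log ‖shapeAt (z t) n‖ + ρ t σ := by
    intro t σ n hn
    simp only [ρ]
    rw [hu _ _ _ (.turn t σ 1 n .refl hn), mul_one, norm_mul, norm_zpow,
      Real.log_mul (zpow_ne_zero _ (norm_ne_zero_iff.2 (hz0 t n))) (norm_ne_zero_iff.2 (hu0 _)),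
      Real.log_zpow]
  have hflip : ∀ t σ, ρ t (σ * Equiv.swap 1 2) = ρ t σ := by
    intro t σ
    simp only [ρ]
    rw [hu _ _ _ (.flip t σ 1 .refl), neg_one_mul, norm_neg]
  have hcross : ∀ t σ, ρ (𝒯.adj t (σ 3)) (𝒯.glue t (σ 3) * σ) = ρ t σ := by
    intro t σ
    simp only [ρ]
    rw [hu _ _ _ (.cross t σ 1 .refl), one_mul]
  obtain ⟨l, hl⟩ := exists_length_of_sideLength (𝒯 := 𝒯) hturn hcross
  -- the sides of the triangle at the vertex `σ 0` in terms of the lengths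
  have hρ : ∀ t (σ : Equiv.Perm (Fin 4)) (n m k : Fin 6),
      s(edgeFst n, edgeSnd n) = s(σ 0, σ 1) → s(edgeFst m, edgeSnd m) = s(σ 0, σ 2) →
      s(edgeFst k, edgeSnd k) = s(σ 1, σ 2) →
      ρ t σ = (l (𝒯.edge t k) - l (𝒯.edge t n) - l (𝒯.edge t m)) / 2 := by
    intro t σ n m k hn hm hk
    have e1 : Equiv.swap 1 2 * Equiv.swap 0 1 =
      (Equiv.swap 0 1 * Equiv.swap 1 2 * Equiv.swap 0 1 * Equiv.swap 1 2 : Equiv.Perm (Fin 4)) := by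
      decide
    have e2 : Equiv.swap 0 1 * Equiv.swap 1 2 * Equiv.swap 0 1 =
      (Equiv.swap 1 2 * Equiv.swap 0 1 * Equiv.swap 1 2 : Equiv.Perm (Fin 4)) := by decide
    have hn' := hl t n σ hn
    have hm' := hl t m (σ * Equiv.swap 1 2) hm
    have hk' := hl t k (σ * Equiv.swap 0 1 * Equiv.swap 1 2) hk
    have f1 := hflip t (σ * Equiv.swap 0 1)
    have f2 := hflip t (σ * Equiv.swap 1 2 * Equiv.swap 0 1)
    have f3 := hflip t σ
    have f4 : σ * Equiv.swap 0 1 * Equiv.swap 1 2 * Equiv.swap 0 1 =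
        σ * Equiv.swap 1 2 * Equiv.swap 0 1 * Equiv.swap 1 2 := by
      simp only [mul_assoc] at e2 ⊢
      rw [e2]
    rw [f4] at hk'
    linarith
  refine ⟨l, ?_⟩
  have htet : ∀ t, 𝒯.tetLengths l t ∈ tetAdmissible ∧
      ∀ n, lawAngle (𝒯.tetLengths l t) n = (Complex.log (shapeAt (z t) n)).im := by
    intro t
    have r1 := hρ t 1 0 1 5 rfl rfl rfl
    have r2 := hρ t (1 * Equiv.swap 2 3) 0 2 4 (by decide) (by decide) (by decide)
    have r3 := hρ t (1 * Equiv.swap 1 2 * Equiv.swap 2 3) 1 2 3 (by decide) (by decide) (by decide)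
    rw [hturn t 1 0 rfl] at r2
    rw [hturn t (1 * Equiv.swap 1 2) 1 (by decide), hflip, one_mul,
      Equiv.Perm.sign_swap (by decide)] at r3
    have s0 : shapeAt (z t) 0 = z t := rfl
    have s1 : shapeAt (z t) 1 = 1 / (1 - z t) := rfl
    rw [s1, norm_div, norm_one, one_div, Real.log_inv, norm_sub_rev] at r3
    rw [s0, Equiv.Perm.sign_one] at r2
    push_cast at r2 r3
    refine lawAngle_eq_log_shapeAt_im (hz t) ?_ ?_
    · change (l (𝒯.edge t 0) + l (𝒯.edge t 3)) / 2 - (l (𝒯.edge t 2) + l (𝒯.edge t 5)) / 2 = _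
      linarith
    · change (l (𝒯.edge t 1) + l (𝒯.edge t 4)) / 2 - (l (𝒯.edge t 2) + l (𝒯.edge t 5)) / 2 = _
      linarith
  refine ⟨fun t => (htet t).1, funext fun e => ?_⟩
  have h1 := congrArg Complex.im (hlog e)
  rw [Complex.im_sum] at h1
  simp at h1
  unfold extendedRicci
  simp only [extendedAngle_eq_lawAngle, (htet _).2, Pi.zero_apply]
  rw [← h1]
  simp

end IdealTriangulation

namespace IdealTriangulation

variable {T : Type*} [Fintype T] {𝒯 : IdealTriangulation T}

/-! ### Convergence of the extended flow -/

/-- Initial values with the cusp lengths of a flat polyhedral metric `l` are attracted by it: the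
flow stays in the affine space `l + ker C` and in a bounded set, on which the curvature is strongly
monotone at `l`. -/
theorem extendedFlowConvergesTo_of_mulVec_eq (h𝒯 : 𝒯.IsCusped) {l l₀ : 𝒯.Edge → ℝ}
    (hl : l ∈ 𝒯.polyhedralMetrics) (hK : 𝒯.extendedRicci l = 0)
    (hC : 𝒯.cuspMatrix *ᵥ l₀ = 𝒯.cuspMatrix *ᵥ l) : 𝒯.ExtendedFlowConvergesTo l₀ l := by
  obtain ⟨M, hM⟩ := 𝒯.exists_norm_extendedRicci_le
  have hdiss := 𝒯.isDissipative_extendedRicci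
  obtain ⟨u, hu0, hu⟩ := hdiss.exists_integralCurve 𝒯.continuous_extendedRicci hM l₀
  have hcusp : ∀ t ∈ Ici (0 : ℝ), 𝒯.cuspMatrix *ᵥ (u t - l) = 0 := by
    intro t ht
    have hd : ∀ s ∈ Ici (0 : ℝ),
        HasDerivWithinAt (fun s => 𝒯.cuspMatrix *ᵥ u s) 0 (Ici 0) s := fun s hs => by
      have h := (LinearMap.toContinuousLinearMap 𝒯.cuspMatrix.mulVecLin).hasFDerivAt
        |>.comp_hasDerivWithinAt s (hu s hs)
      exact h.congr_deriv (𝒯.cuspMatrix_mulVec_extendedRicci h𝒯 _)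
    have hconst : 𝒯.cuspMatrix *ᵥ u t = 𝒯.cuspMatrix *ᵥ u 0 := by
      have h := (convex_Ici (0 : ℝ)).norm_image_sub_le_of_norm_hasDerivWithin_le hd
        (fun s _ => norm_zero.le) self_mem_Ici ht
      rw [zero_mul] at h
      exact sub_eq_zero.1 (norm_le_zero_iff.1 h)
    rw [mulVec_sub, hconst, hu0, hC, sub_self]
  have hR : ∀ t ∈ Ici (0 : ℝ), ‖u t - l‖ ≤ Real.sqrt ((l₀ - l) ⬝ᵥ (l₀ - l)) + 1 := by
    intro t ht
    have h := hdiss.dotProduct_sub_le (convex_Ici (0 : ℝ)) hu (v := fun _ => l)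
      (fun s _ => by rw [hK]; exact hasDerivWithinAt_const _ _ _) self_mem_Ici ht ht
    rw [hu0] at h
    have := Real.le_sqrt_of_sq_le ((norm_sq_le_dotProduct_self _).trans h)
    linarith
  obtain ⟨c, hc, hmono⟩ := 𝒯.exists_extendedRicci_strongly_monotone hl
    (R := Real.sqrt ((l₀ - l) ⬝ᵥ (l₀ - l)) + 1) (by positivity)
  obtain ⟨κ, hκ, henergy⟩ := 𝒯.exists_mul_dotProduct_le_shapeEnergy
  refine ⟨u, ⟨hu0, hu⟩, fun τ u' hτ hu' t ht => ?_, _, c * κ, by positivity, fun t ht =>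
    norm_sub_le_exp_of_dotProduct_le hu (fun t ht => ?_) ht⟩
  · exact hdiss.eqOn (convex_Ico 0 τ) (fun t ht => ht.1) ⟨le_rfl, hτ⟩ hu'.2
      (fun s hs => (hu s hs.1).mono Ico_subset_Ici_self) (hu'.1.trans hu0.symm) ht
  · have h1 := hmono (u t - l) (hR t ht)
    rw [add_sub_cancel, hK, sub_zero] at h1
    have h2 := mul_le_mul_of_nonneg_left (henergy _ (hcusp t ht)) hc.le
    linarith

/-- Limits of the extended flow have zero extended curvature. -/
theorem ExtendedFlowConvergesTo.extendedRicci_eq_zero {l₀ l : 𝒯.Edge → ℝ}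
    (h : 𝒯.ExtendedFlowConvergesTo l₀ l) : 𝒯.extendedRicci l = 0 := by
  obtain ⟨u, ⟨-, hu⟩, -, A, c, hc, hA⟩ := h
  refine eq_zero_of_integralCurve_tendsto 𝒯.continuous_extendedRicci hu ?_
  rw [tendsto_iff_norm_sub_tendsto_zero]
  have h1 : Tendsto (fun t : ℝ => A * Real.exp (-(c * t))) atTop (𝓝 (A * 0)) :=
    (Real.tendsto_exp_neg_atTop_nhds_zero.comp (tendsto_id.const_mul_atTop hc)).const_mul A
  rw [mul_zero] at h1
  refine squeeze_zero' (Eventually.of_forall fun _ => norm_nonneg _) ?_ h1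
  filter_upwards [eventually_ge_atTop 0] with t ht using hA t ht

/-- Rigidity: by strong monotonicity at a flat polyhedral metric, every zero of the extended
curvature differs from it by a similarity of the cross sections of each tetrahedron, and so it is a polyhedral
metric as well. -/
theorem mem_polyhedralMetrics_of_extendedRicci_eq_zero {l l' : 𝒯.Edge → ℝ}
    (hl : l ∈ 𝒯.polyhedralMetrics) (hK : 𝒯.extendedRicci l = 0)
    (hK' : 𝒯.extendedRicci l' = 0) : l' ∈ 𝒯.polyhedralMetrics := by
  obtain ⟨c, hc, hmono⟩ := 𝒯.exists_extendedRicci_strongly_monotone hl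
    (R := ‖l' - l‖ + 1) (by positivity)
  have h := hmono (l' - l) (by linarith)
  rw [add_sub_cancel, hK, hK', sub_zero, zero_dotProduct] at h
  have hE : 𝒯.shapeEnergy (l' - l) ≤ 0 := by
    by_contra hpos
    nlinarith
  have h0 : ∀ t, oppositeDiff 0 (𝒯.tetLengths (l' - l) t) = 0 ∧
      oppositeDiff 1 (𝒯.tetLengths (l' - l) t) = 0 := by
    intro t
    have h1 := (Finset.single_le_sum (f := fun t => oppositeDiff 0 (𝒯.tetLengths (l' - l) t) ^ 2 +
      oppositeDiff 1 (𝒯.tetLengths (l' - l) t) ^ 2) (fun t _ => by positivity)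
      (Finset.mem_univ t)).trans hE
    constructor <;> nlinarith [sq_nonneg (oppositeDiff 0 (𝒯.tetLengths (l' - l) t)),
      sq_nonneg (oppositeDiff 1 (𝒯.tetLengths (l' - l) t))]
  have h1 := 𝒯.add_mem_polyhedralMetrics (fun t => (h0 t).1) (fun t => (h0 t).2) hl
  rwa [add_sub_cancel] at h1

theorem extendedRicci_add_transpose_mulVec (l : 𝒯.Edge → ℝ) (x : 𝒯.Cusp → ℝ) :
    𝒯.extendedRicci (l + 𝒯.cuspMatrixᵀ *ᵥ x) = 𝒯.extendedRicci l :=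
  𝒯.extendedRicci_add_of_oppositeDiff
    (fun t => 𝒯.oppositeDiff_tetLengths_transpose_mulVec x t 0)
    (fun t => 𝒯.oppositeDiff_tetLengths_transpose_mulVec x t 1) l

theorem exists_extendedFlowConvergesTo_add (h𝒯 : 𝒯.IsCusped) {l : 𝒯.Edge → ℝ}
    (hl : l ∈ 𝒯.polyhedralMetrics) (hK : 𝒯.extendedRicci l = 0) (l₀ : 𝒯.Edge → ℝ) :
    ∃ x : 𝒯.Cusp → ℝ, 𝒯.ExtendedFlowConvergesTo l₀ (l + 𝒯.cuspMatrixᵀ *ᵥ x) := by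
  obtain ⟨x, hx⟩ := exists_mulVec_transpose_mulVec_eq 𝒯.cuspMatrix (l₀ - l)
  refine ⟨x, extendedFlowConvergesTo_of_mulVec_eq h𝒯 ?_ ?_ ?_⟩
  · exact 𝒯.add_mem_polyhedralMetrics
      (fun t => 𝒯.oppositeDiff_tetLengths_transpose_mulVec x t 0)
      (fun t => 𝒯.oppositeDiff_tetLengths_transpose_mulVec x t 1) hl
  · rw [extendedRicci_add_transpose_mulVec, hK]
  · rw [mulVec_add, hx, mulVec_sub, add_sub_cancel]

theorem extendedRicci_eq_zero_iff {l : 𝒯.Edge → ℝ} (hl : l ∈ 𝒯.polyhedralMetrics) :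
    𝒯.extendedRicci l = 0 ↔ ∀ e, 𝒯.ricci l e = 0 := by
  rw [funext_iff]
  simp only [𝒯.extendedRicci_eq_ricci hl, Pi.zero_apply]

end IdealTriangulation

theorem mainTheorem1 {T : Type*} [Fintype T] (𝒯 : IdealTriangulation T) (h𝒯 : 𝒯.IsCusped) :
    (𝒯.HasCompleteHyperbolicMetric → ∀ lstar : 𝒯.Edge → ℝ,
      ((lstar ∈ 𝒯.polyhedralMetrics ∧ ∀ e, 𝒯.ricci lstar e = 0) ↔
        ∀ l₀ : 𝒯.Edge → ℝ, ∃ x : 𝒯.Cusp → ℝ,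
          𝒯.ExtendedFlowConvergesTo l₀ (lstar + 𝒯.cuspMatrixᵀ *ᵥ x)) ∧
      ((lstar ∈ 𝒯.polyhedralMetrics ∧ ∀ e, 𝒯.ricci lstar e = 0) ↔
        ∀ l₀ : 𝒯.Edge → ℝ, 𝒯.cuspMatrix *ᵥ l₀ = 𝒯.cuspMatrix *ᵥ lstar →
          𝒯.ExtendedFlowConvergesTo l₀ lstar)) ∧
    (∀ lstar ∈ 𝒯.polyhedralMetrics,
      ((∀ e, 𝒯.ricci lstar e = 0) ↔
        ∀ l₀ : 𝒯.Edge → ℝ, ∃ x : 𝒯.Cusp → ℝ,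
          𝒯.ExtendedFlowConvergesTo l₀ (lstar + 𝒯.cuspMatrixᵀ *ᵥ x)) ∧
      ((∀ e, 𝒯.ricci lstar e = 0) ↔
        ∀ l₀ : 𝒯.Edge → ℝ, 𝒯.cuspMatrix *ᵥ l₀ = 𝒯.cuspMatrix *ᵥ lstar →
          𝒯.ExtendedFlowConvergesTo l₀ lstar)) := by
  have h12 : ∀ l ∈ 𝒯.polyhedralMetrics, (∀ e, 𝒯.ricci l e = 0) → ∀ l₀, ∃ x : 𝒯.Cusp → ℝ,
      𝒯.ExtendedFlowConvergesTo l₀ (l + 𝒯.cuspMatrixᵀ *ᵥ x) := fun l hl hK =>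
    IdealTriangulation.exists_extendedFlowConvergesTo_add h𝒯 hl
      ((IdealTriangulation.extendedRicci_eq_zero_iff hl).2 hK)
  have h13 : ∀ l ∈ 𝒯.polyhedralMetrics, (∀ e, 𝒯.ricci l e = 0) → ∀ l₀,
      𝒯.cuspMatrix *ᵥ l₀ = 𝒯.cuspMatrix *ᵥ l → 𝒯.ExtendedFlowConvergesTo l₀ l :=
    fun l hl hK _ => IdealTriangulation.extendedFlowConvergesTo_of_mulVec_eq h𝒯 hl
      ((IdealTriangulation.extendedRicci_eq_zero_iff hl).2 hK)
  have h2 : ∀ l, (∀ l₀, ∃ x : 𝒯.Cusp → ℝ,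
      𝒯.ExtendedFlowConvergesTo l₀ (l + 𝒯.cuspMatrixᵀ *ᵥ x)) → 𝒯.extendedRicci l = 0 := by
    intro l h
    obtain ⟨x, hx⟩ := h l
    rw [← IdealTriangulation.extendedRicci_add_transpose_mulVec l x]
    exact hx.extendedRicci_eq_zero
  have h3 : ∀ l, (∀ l₀, 𝒯.cuspMatrix *ᵥ l₀ = 𝒯.cuspMatrix *ᵥ l →
      𝒯.ExtendedFlowConvergesTo l₀ l) → 𝒯.extendedRicci l = 0 := fun l h =>
    (h l rfl).extendedRicci_eq_zero
  refine ⟨fun hhyp l => ?_, fun l hl => ⟨⟨h12 l hl, fun h => ?_⟩, ⟨h13 l hl, fun h => ?_⟩⟩⟩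
  · obtain ⟨l', hl', hK'⟩ := hhyp.exists_extendedRicci_eq_zero
    have hflat : 𝒯.extendedRicci l = 0 →
        l ∈ 𝒯.polyhedralMetrics ∧ ∀ e, 𝒯.ricci l e = 0 := fun hK => by
      have hl := IdealTriangulation.mem_polyhedralMetrics_of_extendedRicci_eq_zero hl' hK' hK
      exact ⟨hl, (IdealTriangulation.extendedRicci_eq_zero_iff hl).1 hK⟩
    exact ⟨⟨fun h => h12 l h.1 h.2, fun h => hflat (h2 l h)⟩,
      ⟨fun h => h13 l h.1 h.2, fun h => hflat (h3 l h)⟩⟩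
  · exact (IdealTriangulation.extendedRicci_eq_zero_iff hl).1 (h2 l h)
  · exact (IdealTriangulation.extendedRicci_eq_zero_iff hl).1 (h3 l h)
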